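/- Let $\varphi:(0,\infty)\to(0,\infty)$ satisfy: (i) $\varphi\in C^1((0,\infty))$; (ii) $(s\varphi(s))'>0$ for all $s>0$; (iii) the range of $s\mapsto s\varphi(s)$ is $(0,\infty)$; (iv) there are $s_0>0$, $C_1,C_2>0$ and $r>-1$ with $C_1s^r\le (s\varphi(s))'\le C_2s^r$ for $0<s<s_0$, and if $r=0$ then moreover the finite limit $\lim_{s\to0^+}\varphi(s)>0$ exists and $\lim_{s\to0^+}s\varphi'(s)=0$; (v) there is $s_1>s_0$ such that either $\varphi'(s)\ge 0$ for all $s\ge s_1$ or $\varphi'(s)\le 0$ for all $s\ge s_1$. Put $\Phi(s)=\int_0^s\sigma\varphi(\sigma)\,d\sigma$. Let $\zeta$ be the inverse of the increasing bijection $s\mapsto s\sqrt{\varphi(s)}$ of $(0,\infty)$, and set $\Theta(t)=\zeta(t)/t$, $\Lambda(t)=t\,\Theta'(t)/\Theta(t)$ and $\Lambda_\infty^2=\sup_{t>0}\Lambda(t)^2$. Let $\Omega$ be a domain (a non-empty connected open set) in $\mathbb R^N$, let $\mathring H^1(\Omega)$ be the closure of the complex-valued functions in $C_c^\infty(\Omega)$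 in the norm $\big(\int_\Omega(|u|^2+|\nabla u|^2)\,dx\big)^{1/2}$, let $\lambda,\mu$ be real constants with $\mu>0$ and $\lambda+2\mu>0$, and suppose that $$\Lambda_\infty^2<\begin{cases}\mu/(\lambda+2\mu), & \text{if } \lambda+\mu>0,\\ (\lambda+2\mu)/\mu, & \text{if } \lambda+\mu\le 0.\end{cases}$$ Then the Lamé operator $Eu=\mu\Delta u+(\lambda+\mu)\nabla\operatorname{div}u$ is strictly $L^\Phi$-dissipative in $\Omega$. That is, there exists $\kappa>0$ such that for every $u\in[\mathring H^1(\Omega)]^N$ with $\varphi(|u|)u\in[\mathring H^1(\Omega)]^N$ one has $\sqrt{\varphi(|u|)}\,u\in[\mathring H^1(\Omega)]^N$ and $$\operatorname{Re}\int_\Omega\sum_{h,k=1}^N\langle \mathcal A^{hk}\partial_k u,\partial_h(\varphi(|u|)u)\rangle\,dx\ \ge\ \kappa\int_\Omega\big|\nabla\big(\sqrt{\varphi(|u|)}\,u\big)\big|^2dx,$$ where $\mathcal A^{hk}=\{a^{hk}_{ij}\}$ with $a^{hk}_{ij}=\mu\,\delta_{ij}\delta_{hk}+(\lambda+\mu)\,\delta_{ih}\delta_{jk}$,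 so that the integrand is $\mu\langle\nabla u,\nabla(\varphi(|u|)u)\rangle+(\lambda+\mu)\operatorname{div}u\;\overline{\operatorname{div}(\varphi(|u|)u)}$. -/

import Mathlib

open MeasureTheory Filter Topology Set
open scoped ContDiff

noncomputable section

/-- The standing conditions on the weight `φ`, regarded as a function on `(0, ∞)`; its values on
`(-∞, 0]` play no role. -/
structure AdmissibleWeight (φ : ℝ → ℝ) : Prop where
  pos : ∀ s, 0 < s → 0 < φ s
  contDiffOn : ContDiffOn ℝ 1 φ (Ioi 0)
  deriv_pos : ∀ s, 0 < s → 0 < deriv (fun t => t * φ t) s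
  range_eq : (fun s => s * φ s) '' Ioi 0 = Ioi 0
  /-- The behaviour near the origin and, beyond the same `s₀`, the behaviour for large `s`. -/
  behaviour : ∃ s₀ : ℝ, 0 < s₀ ∧
    (∃ C₁ C₂ r : ℝ, 0 < C₁ ∧ 0 < C₂ ∧ -1 < r ∧
      (∀ s ∈ Ioo 0 s₀,
        C₁ * s ^ r ≤ deriv (fun t => t * φ t) s ∧ deriv (fun t => t * φ t) s ≤ C₂ * s ^ r) ∧
      (r = 0 →
        (∃ φ₀ : ℝ, 0 < φ₀ ∧ Tendsto φ (𝓝[>] 0) (𝓝 φ₀)) ∧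
        Tendsto (fun s => s * deriv φ s) (𝓝[>] 0) (𝓝 0))) ∧
    ∃ s₁ : ℝ, s₀ < s₁ ∧ ((∀ s, s₁ ≤ s → 0 ≤ deriv φ s) ∨ (∀ s, s₁ ≤ s → deriv φ s ≤ 0))

/-- `ζ`, the inverse on `(0, ∞)` of the strictly increasing function `s ↦ s √φ(s)`. -/
def weightZeta (φ : ℝ → ℝ) : ℝ → ℝ :=
  Function.invFunOn (fun s => s * Real.sqrt (φ s)) (Ioi 0)

/-- `Θ(t) = ζ(t) / t`. -/
def weightTheta (φ : ℝ → ℝ) (t : ℝ) : ℝ := weightZeta φ t / t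

/-- `Λ(t) = t Θ'(t) / Θ(t)`. -/
def weightLambda (φ : ℝ → ℝ) (t : ℝ) : ℝ :=
  t * deriv (weightTheta φ) t / weightTheta φ t

/-- `Λ_∞² = sup_{t > 0} Λ(t)²`. For an admissible weight the supremum is over a bounded set,
because `Λ(s √φ(s)) = -s φ'(s) / (s φ'(s) + 2 φ(s))` and `s φ'(s) + φ(s) > 0`. -/
def weightLambdaInftySq (φ : ℝ → ℝ) : ℝ :=
  sSup ((fun t => weightLambda φ t ^ 2) '' Ioi 0)

/-- The partial derivative `∂_h η` of a vector valued function on `ℝ^N`. -/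
def partialDeriv {N m : ℕ} (h : Fin N)
    (η : EuclideanSpace ℝ (Fin N) → EuclideanSpace ℂ (Fin m)) (x : EuclideanSpace ℝ (Fin N)) :
    EuclideanSpace ℂ (Fin m) :=
  fderiv ℝ η x (EuclideanSpace.single h 1)

/-- `η` belongs to `[C_c^∞(Ω)]^m` (complex valued, compact support contained in `Ω`). -/
structure IsTestField {N m : ℕ} (Ω : Set (EuclideanSpace ℝ (Fin N)))
    (η : EuclideanSpace ℝ (Fin N) → EuclideanSpace ℂ (Fin m)) : Prop where
  contDiff : ContDiff ℝ ∞ η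
  hasCompactSupport : HasCompactSupport η
  tsupport_subset : tsupport η ⊆ Ω

/-- `u` belongs to `[H̊¹(Ω)]^m`, the closure of `[C_c^∞(Ω)]^m` in the norm
`(∫_Ω |u|² + |∇u|²)^{1/2}`, and `G = (∂_1 u, …, ∂_N u)`: the pair `(u, G)` is the limit in `L²(Ω)`
of pairs `(η_n, ∇η_n)` with `η_n` in `[C_c^∞(Ω)]^m`. Such a `G` is the weak gradient of `u` and is
determined by `u` up to null sets of `Ω`. -/
structure HasGradH10 {N m : ℕ} (Ω : Set (EuclideanSpace ℝ (Fin N)))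
    (u : EuclideanSpace ℝ (Fin N) → EuclideanSpace ℂ (Fin m))
    (G : Fin N → EuclideanSpace ℝ (Fin N) → EuclideanSpace ℂ (Fin m)) : Prop where
  memLp : MemLp u 2 (volume.restrict Ω)
  memLp_grad : ∀ h, MemLp (G h) 2 (volume.restrict Ω)
  approx : ∃ η : ℕ → EuclideanSpace ℝ (Fin N) → EuclideanSpace ℂ (Fin m),
    (∀ n, IsTestField Ω (η n)) ∧
    Tendsto (fun n => eLpNorm (fun x => η n x - u x) 2 (volume.restrict Ω)) atTop (𝓝 0) ∧
    ∀ h, Tendsto (fun n => eLpNorm (fun x => partialDeriv h (η n) x - G h x) 2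
      (volume.restrict Ω)) atTop (𝓝 0)

/-- The form `∫_Ω ⟨A^{hk} ∂_k u, ∂_h w⟩ dx` of the operator `∂_h (A^{hk}(x) ∂_k)`, with
`A h k x i j = a^{hk}_{ij}(x)`, as a function of the gradients `Du` and `Dw`. -/
def systemForm {N m : ℕ} (Ω : Set (EuclideanSpace ℝ (Fin N)))
    (A : Fin N → Fin N → EuclideanSpace ℝ (Fin N) → Matrix (Fin m) (Fin m) ℂ)
    (Du Dw : Fin N → EuclideanSpace ℝ (Fin N) → EuclideanSpace ℂ (Fin m)) : ℂ :=
  ∫ x in Ω, ∑ h, ∑ k, ∑ i, ∑ j, A h k x i j * Du k x j * (starRingEnd ℂ) (Dw h x i)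

/-- Strict `L^Φ`-dissipativity of the operator `∂_h (A^{hk}(x) ∂_k)` in `Ω`, where
`Φ(s) = ∫_0^s σ φ(σ) dσ`: there is `κ > 0` such that
`Re ∫_Ω ⟨A^{hk} ∂_k u, ∂_h(φ(|u|) u)⟩ dx ≥ κ ∫_Ω |∇(√φ(|u|) u)|² dx`
for all `u` in `[H̊¹(Ω)]^m` with `φ(|u|) u` in `[H̊¹(Ω)]^m`. That `√φ(|u|) u` is in `[H̊¹(Ω)]^m` as
well, so that the right-hand side is meaningful and finite, is part of the assertion. -/
def IsStrictlyFunctionalDissipative {N m : ℕ} (φ : ℝ → ℝ) (Ω : Set (EuclideanSpace ℝ (Fin N)))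
    (A : Fin N → Fin N → EuclideanSpace ℝ (Fin N) → Matrix (Fin m) (Fin m) ℂ) : Prop :=
  ∃ κ : ℝ, 0 < κ ∧
    ∀ (u : EuclideanSpace ℝ (Fin N) → EuclideanSpace ℂ (Fin m))
      (Du Dw : Fin N → EuclideanSpace ℝ (Fin N) → EuclideanSpace ℂ (Fin m)),
      HasGradH10 Ω u Du →
      HasGradH10 Ω (fun x => φ ‖u x‖ • u x) Dw →
      ∃ Dv : Fin N → EuclideanSpace ℝ (Fin N) → EuclideanSpace ℂ (Fin m),
        HasGradH10 Ω (fun x => Real.sqrt (φ ‖u x‖) • u x) Dv ∧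
        κ * ∫ x in Ω, ∑ h, ‖Dv h x‖ ^ 2 ≤ (systemForm Ω A Du Dw).re

/-- The constant coefficients `a^{hk}_{ij} = μ δ_{ij} δ_{hk} + (λ + μ) δ_{ih} δ_{jk}` of the Lamé
operator `E u = μ Δu + (λ + μ) ∇ div u`, that is
`(E u)_i = ∂_h (a^{hk}_{ij} ∂_k u_j) = μ Δu_i + (λ + μ) ∂_i ∂_j u_j`. -/
def lameCoeff {N : ℕ} (lam mu : ℝ) (h k : Fin N) (_x : EuclideanSpace ℝ (Fin N)) :
    Matrix (Fin N) (Fin N) ℂ :=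
  Matrix.of fun i j =>
    (mu : ℂ) * (if i = j then 1 else 0) * (if h = k then 1 else 0) +
      ((lam : ℂ) + (mu : ℂ)) * (if i = h then 1 else 0) * (if j = k then 1 else 0)

end

/-! Write `w = φ(|u|) u`, `v = √φ(|u|) u`, and, at a point with `|u| = s`, `f = φ(s)` and `p =
(sφ(s))'`. Neither `φ(|u|)` nor its inverse need be bounded, so the chain rule cannot be applied to
`u` directly. But `y = u + w` lies in `H̊¹`, and both `u = a(|y|) y` and `v = b(|y|) y` have bounded
profiles with bounded `t a'(t)`, `t b'(t)` (`AdmissibleWeight.exists_profiles`). The chain rule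
`HasGradH10.radial` then puts `v` in `H̊¹` and expresses all gradients through that of `y`.

Split each `∂_k y = Z_k + R_k`, with `R_k` a real multiple of `y` and `Z_k` orthogonal to `y` for
the real inner product. Then `∇u`, `∇w`, `∇v` are combinations of `Z` and `R` with scalar
coefficients, and for the Lamé form `B` one gets exactly `B(∇u, ∇w) = B(∇v, ∇v) - (f - p)² / (4 f (1
+ p)²) B(R, R)`. Since `Λ(s√φ(s)) = (f - p)/(f + p)`, and since `R` has rank one, the subtracted
term is at most `Λ_∞² M |∇v|²` with `M = μ + max(λ + μ, 0)`; this is `lameForm_radial_ge`.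

After integration, `∫ B(∇v, ∇v) ≥ κ₀ ∫ |∇v|²`, where `κ₀ = μ` if `λ + μ > 0`, and otherwise `κ₀ = λ
+ 2μ` because `∫ |div v|² ≤ ∫ |∇v|²` (`HasGradH10.integral_div_sq_le`). The assumed bound says `Λ_∞²
M < κ₀`, so `κ = κ₀ - Λ_∞² M` works. -/

/-! ### Convergence in `L²` and mollification. -/

theorem tendsto_eLpNorm_two_of_dominated {α F : Type*} [MeasurableSpace α] {μ : Measure α}
    [NormedAddCommGroup F] {f : ℕ → α → F} {g : α → F} {b : α → ℝ}
    (hf : ∀ n, AEStronglyMeasurable (f n) μ) (hb : MemLp b 2 μ)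
    (bound : ∀ n, ∀ᵐ x ∂μ, ‖f n x‖ ≤ b x)
    (lim : ∀ᵐ x ∂μ, Tendsto (fun n => f n x) atTop (𝓝 (g x))) :
    MemLp g 2 μ ∧ Tendsto (fun n => eLpNorm (fun x => f n x - g x) 2 μ) atTop (𝓝 0) := by
  have hg : AEStronglyMeasurable g μ := aestronglyMeasurable_of_tendsto_ae atTop hf lim
  have hgb : ∀ᵐ x ∂μ, ‖g x‖ ≤ b x := by
    filter_upwards [ae_all_iff.2 bound, lim] with x h1 h2
    exact le_of_tendsto h2.norm (Eventually.of_forall h1)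
  have hgm : MemLp g 2 μ := hb.mono' hg hgb
  refine ⟨hgm, ?_⟩
  have key : Tendsto (fun n => ∫⁻ x, ‖f n x - g x‖ₑ ^ (2 : ℝ) ∂μ) atTop (𝓝 (∫⁻ _, 0 ∂μ)) := by
    refine tendsto_lintegral_of_dominated_convergence' (fun x => ‖2 * b x‖ₑ ^ (2 : ℝ))
      (fun n => ((hf n).sub hg).enorm.pow_const _) (fun n => ?_) ?_ ?_
    · filter_upwards [bound n, hgb] with x h1 h2
      gcongr
      rw [← ofReal_norm, ← ofReal_norm]
      apply ENNReal.ofReal_le_ofReal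
      calc ‖f n x - g x‖ ≤ ‖f n x‖ + ‖g x‖ := norm_sub_le _ _
        _ ≤ 2 * b x := by linarith
        _ ≤ _ := Real.le_norm_self _
    · have := (hb.const_mul 2).eLpNorm_lt_top
      rw [eLpNorm_lt_top_iff_lintegral_rpow_enorm_lt_top (by norm_num) (by norm_num)] at this
      simpa using this.ne
    · filter_upwards [lim] with x h
      have h1 : Tendsto (fun n => ‖f n x - g x‖ₑ) atTop (𝓝 0) := by
        have := (h.sub_const (g x)).enorm
        simpa using this
      have := (ENNReal.continuous_rpow_const (y := 2)).tendsto 0 |>.comp h1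
      simpa [Function.comp_def] using this
  have h2 := (ENNReal.continuous_rpow_const (y := (1 / 2 : ℝ))).tendsto _ |>.comp key
  simp only [lintegral_zero] at h2
  rw [ENNReal.zero_rpow_of_pos (by norm_num)] at h2
  refine h2.congr fun n => ?_
  rw [eLpNorm_eq_lintegral_rpow_enorm_toReal (by norm_num) (by norm_num)]
  simp

theorem memLp_of_tendsto_eLpNorm {α F : Type*} [MeasurableSpace α] {μ : Measure α}
    [NormedAddCommGroup F] {f : ℕ → α → F} {g : α → F} (hf : ∀ n, MemLp (f n) 2 μ)
    (hg : AEStronglyMeasurable g μ)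
    (h : Tendsto (fun n => eLpNorm (fun x => f n x - g x) 2 μ) atTop (𝓝 0)) : MemLp g 2 μ := by
  obtain ⟨n, hn⟩ := (h.eventually (gt_mem_nhds zero_lt_one)).exists
  have h1 : MemLp (fun x => f n x - g x) 2 μ := ⟨(hf n).1.sub hg, hn.trans ENNReal.one_lt_top⟩
  exact ((hf n).sub h1).ae_eq (by filter_upwards with x; simp)

section
variable {N m : ℕ} {Ω : Set (EuclideanSpace ℝ (Fin N))}

local notation "E" => EuclideanSpace ℝ (Fin N)
local notation "F" => EuclideanSpace ℂ (Fin m)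

/-- Radii at most `1` keep every mollification inside the closed `1`-thickening of the support,
where it is at most `3C` when `|f| ≤ C`; dominated convergence applies. -/
theorem tendsto_eLpNorm_mollify {f : E → F} (hf : Continuous f) (hc : HasCompactSupport f)
    {b : ℕ → ContDiffBump (0 : E)} (hb : Tendsto (fun n => (b n).rOut) atTop (𝓝 0))
    (hb1 : ∀ n, (b n).rOut ≤ 1) (μ : Measure E) [IsFiniteMeasureOnCompacts μ] :
    Tendsto (fun n => eLpNorm (fun x =>
      convolution ((b n).normed volume) f (ContinuousLinearMap.lsmul ℝ ℝ) volume x - f x) 2 μ)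
      atTop (𝓝 0) := by
  set g : ℕ → E → F := fun n =>
    convolution ((b n).normed volume) f (ContinuousLinearMap.lsmul ℝ ℝ) volume with hg
  obtain ⟨C, hC⟩ := hf.bounded_above_of_compact_support hc
  have hC0 : 0 ≤ C := (norm_nonneg _).trans (hC 0)
  have hK : IsCompact (Metric.cthickening 1 (tsupport f)) :=
    IsCompact.cthickening hc.isCompact
  have hcont : ∀ n, Continuous (g n) := fun n =>
    HasCompactSupport.continuous_convolution_right _ hc
      ((b n).continuous_normed.locallyIntegrable) hf
  refine (tendsto_eLpNorm_two_of_dominated (f := g) (g := f)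
    (b := (Metric.cthickening 1 (tsupport f)).indicator fun _ => 3 * C)
    (fun n => (hcont n).aestronglyMeasurable) ?_ (fun n => ?_) ?_).2
  · exact memLp_indicator_const 2 hK.measurableSet _ (Or.inr hK.measure_lt_top.ne)
  · refine Eventually.of_forall fun x => ?_
    by_cases hx : x ∈ Metric.cthickening 1 (tsupport f)
    · rw [indicator_of_mem hx]
      have h1 : dist (g n x) (f x) ≤ 2 * C :=
        ContDiffBump.dist_normed_convolution_le hf.aestronglyMeasurable fun z _ => by
          rw [dist_eq_norm]
          linarith [norm_sub_le (f z) (f x), hC z, hC x]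
      rw [dist_eq_norm] at h1
      have h2 := norm_le_norm_add_norm_sub (f x) (g n x)
      rw [norm_sub_rev] at h2
      have := norm_sub_norm_le (g n x) (f x)
      linarith [hC x]
    · rw [indicator_of_notMem hx]
      have : g n x = 0 := by
        by_contra hne
        apply hx
        have h1 := support_convolution_subset (ContinuousLinearMap.lsmul ℝ ℝ) (show x ∈ Function.support (g n) from hne)
        obtain ⟨p, hp, q, hq, rfl⟩ := h1
        rw [ContDiffBump.support_normed_eq] at hp
        refine Metric.mem_cthickening_of_dist_le _ q _ _ (subset_tsupport _ hq) ?_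
        simp only [Metric.mem_ball, dist_zero_right] at hp
        rw [dist_eq_norm, add_sub_cancel_right]
        exact hp.le.trans (hb1 n)
      simp [this]
  · exact Eventually.of_forall fun x =>
      ContDiffBump.convolution_tendsto_right_of_continuous hb hf x

theorem tsupport_partialDeriv_subset (f : E → F) (h : Fin N) :
    tsupport (partialDeriv h f) ⊆ tsupport f := by
  refine closure_minimal (fun x hx => ?_) (isClosed_tsupport f)
  by_contra hx'
  apply hx
  have := notMem_tsupport_iff_eventuallyEq.1 hx'
  simp [partialDeriv, this.fderiv_eq]

theorem hasCompactSupport_partialDeriv {f : E → F} (hc : HasCompactSupport f) (h : Fin N) :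
    HasCompactSupport (partialDeriv h f) :=
  hc.of_isClosed_subset (isClosed_tsupport _) (tsupport_partialDeriv_subset f h)

theorem continuous_partialDeriv {f : E → F} (hf : ContDiff ℝ 1 f) (h : Fin N) :
    Continuous (partialDeriv h f) :=
  (hf.continuous_fderiv (by norm_num)).clm_apply continuous_const

/-- Composing a test field with a `C¹` map leaves only a `C¹` field, while `H̊¹` is defined by
smooth ones. Mollifying at radii below the distance from the support to the boundary closes the gap,
since differentiation commutes with the convolution. -/
theorem hasGradH10_of_contDiff_one {f : E → F} (hf : ContDiff ℝ 1 f) (hc : HasCompactSupport f)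
    (hΩ : IsOpen Ω) (hs : tsupport f ⊆ Ω) :
    HasGradH10 Ω f (fun h => partialDeriv h f) := by
  refine ⟨hf.continuous.memLp_of_hasCompactSupport hc,
    fun h => (continuous_partialDeriv hf h).memLp_of_hasCompactSupport (hasCompactSupport_partialDeriv hc h), ?_⟩
  obtain ⟨δ, hδ, hδs⟩ := hc.isCompact.exists_cthickening_subset_open hΩ hs
  -- The bound by `δ` keeps the supports in `Ω`; the bound by `1` is what `tendsto_eLpNorm_mollify`
  -- asks for.
  have hr : ∀ n : ℕ, 0 < min δ 1 / (n + 1) := fun n => by positivity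
  let b : ℕ → ContDiffBump (0 : E) := fun n =>
    ⟨min δ 1 / (n + 1) / 2, min δ 1 / (n + 1), by have := hr n; positivity,
      half_lt_self (hr n)⟩
  have hbr : ∀ n, (b n).rOut = min δ 1 / (n + 1) := fun n => rfl
  have hble : ∀ n, (b n).rOut ≤ min δ 1 := fun n => by
    rw [hbr]
    exact div_le_self (by positivity) (by linarith [n.cast_nonneg (α := ℝ)])
  have hb0 : Tendsto (fun n => (b n).rOut) atTop (𝓝 0) := by
    simp only [hbr]
    simpa [div_eq_mul_inv] using (tendsto_one_div_add_atTop_nhds_zero_nat (𝕜 := ℝ)).const_mul (min δ 1)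
  have hb1 : ∀ n, (b n).rOut ≤ 1 := fun n => (hble n).trans (min_le_right _ _)
  have hpd : ∀ n h, partialDeriv h
      (convolution ((b n).normed volume) f (ContinuousLinearMap.lsmul ℝ ℝ) volume) =
      convolution ((b n).normed volume) (partialDeriv h f) (ContinuousLinearMap.lsmul ℝ ℝ)
        volume := by
    intro n h
    ext1 x
    have hl : LocallyIntegrable ((b n).normed volume) (volume : Measure E) :=
      (b n).continuous_normed.locallyIntegrable
    have := (HasCompactSupport.hasFDerivAt_convolution_right (ContinuousLinearMap.lsmul ℝ ℝ)
      hc hl hf x).fderiv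
    rw [partialDeriv, this, convolution_precompR_apply _ hl (hc.fderiv ℝ)
      (hf.continuous_fderiv (by norm_num))]
    rfl
  refine ⟨fun n => convolution ((b n).normed volume) f (ContinuousLinearMap.lsmul ℝ ℝ) volume,
    fun n => ?_, tendsto_eLpNorm_mollify hf.continuous hc hb0 hb1 _, fun h => ?_⟩
  · have hsub : Function.support (convolution ((b n).normed volume) f
        (ContinuousLinearMap.lsmul ℝ ℝ) volume) ⊆ Metric.cthickening δ (tsupport f) := by
      intro x hx
      obtain ⟨p, hp, q, hq, rfl⟩ := support_convolution_subset _ hx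
      rw [ContDiffBump.support_normed_eq] at hp
      refine Metric.mem_cthickening_of_dist_le _ q _ _ (subset_tsupport _ hq) ?_
      simp only [Metric.mem_ball, dist_zero_right] at hp
      rw [dist_eq_norm, add_sub_cancel_right]
      exact hp.le.trans ((hble n).trans (min_le_left _ _))
    have hts := closure_minimal hsub Metric.isClosed_cthickening
    exact ⟨HasCompactSupport.contDiff_convolution_left _ (b n).hasCompactSupport_normed
      (b n).contDiff_normed hf.continuous.locallyIntegrable,
      (IsCompact.cthickening hc.isCompact).of_isClosed_subset (isClosed_tsupport _) hts, hts.trans hδs⟩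
  · simp only [hpd]
    exact tendsto_eLpNorm_mollify (continuous_partialDeriv hf h) (hasCompactSupport_partialDeriv hc h) hb0 hb1 _

end

/-! ### The space `H̊¹`: closedness, sums, chain rule, uniqueness of the gradient. -/

section
variable {N m : ℕ} {Ω : Set (EuclideanSpace ℝ (Fin N))}

local notation "E" => EuclideanSpace ℝ (Fin N)
local notation "F" => EuclideanSpace ℂ (Fin m)

theorem HasGradH10.exists_testField {u : E → F} {G : Fin N → E → F} (hu : HasGradH10 Ω u G)
    {ε : ENNReal} (hε : 0 < ε) : ∃ η : E → F, IsTestField Ω η ∧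
      eLpNorm (fun x => η x - u x) 2 (volume.restrict Ω) < ε ∧
      ∀ h, eLpNorm (fun x => partialDeriv h η x - G h x) 2 (volume.restrict Ω) < ε := by
  obtain ⟨η, h1, h2, h3⟩ := hu.approx
  have := (h2.eventually (gt_mem_nhds hε)).and
    (eventually_all.2 fun h => (h3 h).eventually (gt_mem_nhds hε))
  obtain ⟨n, hn⟩ := this.exists
  exact ⟨η n, h1 n, hn⟩

/-- A diagonal choice: replace the `n`-th element by a test field within `1/(n+1)` of it, in value
and in gradient. -/
theorem hasGradH10_of_tendsto {u : E → F} {G : Fin N → E → F} {v : ℕ → E → F}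
    {H : ℕ → Fin N → E → F} (hv : ∀ n, HasGradH10 Ω (v n) (H n))
    (hu : AEStronglyMeasurable u (volume.restrict Ω))
    (hG : ∀ h, AEStronglyMeasurable (G h) (volume.restrict Ω))
    (h1 : Tendsto (fun n => eLpNorm (fun x => v n x - u x) 2 (volume.restrict Ω)) atTop (𝓝 0))
    (h2 : ∀ h, Tendsto (fun n => eLpNorm (fun x => H n h x - G h x) 2 (volume.restrict Ω))
      atTop (𝓝 0)) : HasGradH10 Ω u G := by
  refine ⟨memLp_of_tendsto_eLpNorm (fun n => (hv n).memLp) hu h1,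
    fun h => memLp_of_tendsto_eLpNorm (fun n => (hv n).memLp_grad h) (hG h) (h2 h), ?_⟩
  have hpos : ∀ n : ℕ, (0 : ENNReal) < ((n : ENNReal) + 1)⁻¹ := fun n => by
    simp
  have h0 : Tendsto (fun n : ℕ => ((n : ENNReal) + 1)⁻¹) atTop (𝓝 0) := by
    have := ENNReal.tendsto_inv_nat_nhds_zero.comp (tendsto_add_atTop_nat 1)
    simpa [Function.comp_def] using this
  choose η hη hη1 hη2 using fun n => (hv n).exists_testField (hpos n)
  refine ⟨η, hη, ?_, fun h => ?_⟩
  · have hs := h0.add h1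
    rw [add_zero] at hs
    refine tendsto_of_tendsto_of_tendsto_of_le_of_le tendsto_const_nhds hs
      (fun _ => zero_le) fun n => ?_
    have := eLpNorm_add_le (((hη n).contDiff.continuous.aestronglyMeasurable
      (μ := volume.restrict Ω)).sub (hv n).memLp.1) ((hv n).memLp.1.sub hu)
      (p := 2) (by norm_num)
    rw [sub_add_sub_cancel] at this
    exact this.trans (add_le_add (hη1 n).le le_rfl)
  · have hs := h0.add (h2 h)
    rw [add_zero] at hs
    refine tendsto_of_tendsto_of_tendsto_of_le_of_le tendsto_const_nhds hs
      (fun _ => zero_le) fun n => ?_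
    have := eLpNorm_add_le (((continuous_partialDeriv ((hη n).contDiff.of_le (by simp))
      h).aestronglyMeasurable
      (μ := volume.restrict Ω)).sub ((hv n).memLp_grad h).1) (((hv n).memLp_grad h).1.sub (hG h))
      (p := 2) (by norm_num)
    rw [sub_add_sub_cancel] at this
    exact this.trans (add_le_add (hη2 n h).le le_rfl)

theorem IsTestField.contDiff_one {η : E → F} (h : IsTestField Ω η) : ContDiff ℝ 1 η :=
  h.contDiff.of_le (by simp)

theorem IsTestField.add {η θ : E → F} (h1 : IsTestField Ω η) (h2 : IsTestField Ω θ) :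
    IsTestField Ω (fun x => η x + θ x) :=
  ⟨h1.contDiff.add h2.contDiff, h1.hasCompactSupport.add h2.hasCompactSupport,
    (tsupport_add η θ).trans (union_subset h1.tsupport_subset h2.tsupport_subset)⟩

theorem partialDeriv_add {η θ : E → F} (h1 : ContDiff ℝ 1 η) (h2 : ContDiff ℝ 1 θ) (h : Fin N)
    (x : E) : partialDeriv h (fun x => η x + θ x) x = partialDeriv h η x + partialDeriv h θ x := by
  simp only [partialDeriv]
  rw [fderiv_fun_add (h1.differentiable (by norm_num) x) (h2.differentiable (by norm_num) x)]
  rfl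

theorem HasGradH10.add {u w : E → F} {G H : Fin N → E → F} (hu : HasGradH10 Ω u G)
    (hw : HasGradH10 Ω w H) :
    HasGradH10 Ω (fun x => u x + w x) (fun h x => G h x + H h x) := by
  refine ⟨hu.memLp.add hw.memLp, fun h => (hu.memLp_grad h).add (hw.memLp_grad h), ?_⟩
  obtain ⟨η, h1, h2, h3⟩ := hu.approx
  obtain ⟨θ, k1, k2, k3⟩ := hw.approx
  refine ⟨fun n x => η n x + θ n x, fun n => (h1 n).add (k1 n), ?_, fun h => ?_⟩
  · have hs := h2.add k2
    rw [add_zero] at hs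
    refine tendsto_of_tendsto_of_tendsto_of_le_of_le tendsto_const_nhds hs
      (fun _ => zero_le) fun n => ?_
    have := eLpNorm_add_le (((h1 n).contDiff.continuous.aestronglyMeasurable
      (μ := volume.restrict Ω)).sub hu.memLp.1)
      (((k1 n).contDiff.continuous.aestronglyMeasurable (μ := volume.restrict Ω)).sub hw.memLp.1)
      (p := 2) (by norm_num)
    rw [sub_add_sub_comm] at this
    exact this
  · have hs := (h3 h).add (k3 h)
    rw [add_zero] at hs
    refine tendsto_of_tendsto_of_tendsto_of_le_of_le tendsto_const_nhds hs
      (fun _ => zero_le) fun n => ?_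
    have := eLpNorm_add_le (((continuous_partialDeriv (h1 n).contDiff_one h).aestronglyMeasurable
      (μ := volume.restrict Ω)).sub (hu.memLp_grad h).1)
      (((continuous_partialDeriv (k1 n).contDiff_one h).aestronglyMeasurable
      (μ := volume.restrict Ω)).sub (hw.memLp_grad h).1)
      (p := 2) (by norm_num)
    rw [sub_add_sub_comm] at this
    simp only [partialDeriv_add (h1 n).contDiff_one (k1 n).contDiff_one]
    exact this

theorem HasGradH10.congr_grad {u : E → F} {G H : Fin N → E → F} (hu : HasGradH10 Ω u G)
    (h : ∀ k, G k =ᵐ[volume.restrict Ω] H k) : HasGradH10 Ω u H := by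
  refine ⟨hu.memLp, fun k => (hu.memLp_grad k).ae_eq (h k), ?_⟩
  obtain ⟨η, h1, h2, h3⟩ := hu.approx
  refine ⟨η, h1, h2, fun k => (h3 k).congr fun n => eLpNorm_congr_ae ?_⟩
  filter_upwards [h k] with x hx
  rw [hx]

/-- Pointwise convergence, along a subsequence, is needed because the derivative of an outer map is
merely continuous, not Lipschitz. -/
theorem HasGradH10.exists_approx_ae {u : E → F} {G : Fin N → E → F} (hu : HasGradH10 Ω u G) :
    ∃ η : ℕ → E → F, (∀ n, IsTestField Ω (η n)) ∧
    Tendsto (fun n => eLpNorm (fun x => η n x - u x) 2 (volume.restrict Ω)) atTop (𝓝 0) ∧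
    (∀ h, Tendsto (fun n => eLpNorm (fun x => partialDeriv h (η n) x - G h x) 2
      (volume.restrict Ω)) atTop (𝓝 0)) ∧
    ∀ᵐ x ∂(volume.restrict Ω), Tendsto (fun n => η n x) atTop (𝓝 (u x)) := by
  obtain ⟨η, h1, h2, h3⟩ := hu.approx
  obtain ⟨ns, hns, hae⟩ := (tendstoInMeasure_of_tendsto_eLpNorm (p := 2) (by norm_num)
    (fun n => (h1 n).contDiff.continuous.aestronglyMeasurable) hu.memLp.1 h2).exists_seq_tendsto_ae
  exact ⟨fun n => η (ns n), fun n => h1 _, h2.comp hns.tendsto_atTop,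
    fun h => (h3 h).comp hns.tendsto_atTop, hae⟩

/-- Chain rule in `H̊¹` for a `C¹` map with bounded derivative that fixes the origin. -/
theorem HasGradH10.comp_contDiff {y : E → F} {Dy : Fin N → E → F} (hy : HasGradH10 Ω y Dy)
    (hΩ : IsOpen Ω) {T : F → F} (hT : ContDiff ℝ 1 T) (hT0 : T 0 = 0) {C : ℝ}
    (hC : ∀ ξ, ‖fderiv ℝ T ξ‖ ≤ C) :
    HasGradH10 Ω (fun x => T (y x)) (fun h x => fderiv ℝ T (y x) (Dy h x)) := by
  have hC0 : 0 ≤ C := (norm_nonneg _).trans (hC 0)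
  have hTd : Differentiable ℝ T := hT.differentiable (by norm_num)
  have hTf : Continuous (fderiv ℝ T) := hT.continuous_fderiv (by norm_num)
  have hLip : ∀ a b, ‖T a - T b‖ ≤ C * ‖a - b‖ := fun a b =>
    convex_univ.norm_image_sub_le_of_norm_fderiv_le (fun z _ => hTd z) (fun z _ => hC z)
      (mem_univ b) (mem_univ a)
  obtain ⟨η, h1, h2, h3, h4⟩ := hy.exists_approx_ae
  have hpd : ∀ n h, partialDeriv h (fun x => T (η n x)) =
      fun x => fderiv ℝ T (η n x) (partialDeriv h (η n) x) := by
    intro n h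
    ext1 x
    rw [partialDeriv, show (fun x => T (η n x)) = T ∘ η n from rfl,
      fderiv_comp _ (hTd _) ((h1 n).contDiff_one.differentiable (by norm_num) x)]
    rfl
  have hmeasη : ∀ n, AEStronglyMeasurable (η n) (volume.restrict Ω) :=
    fun n => (h1 n).contDiff.continuous.aestronglyMeasurable
  have happ : Continuous fun p : (F →L[ℝ] F) × F => p.1 p.2 := by fun_prop
  have hmT : ∀ h {z : E → F}, AEStronglyMeasurable z (volume.restrict Ω) →
      AEStronglyMeasurable (fun x => fderiv ℝ T (z x) (Dy h x)) (volume.restrict Ω) :=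
    fun h z hz => happ.comp_aestronglyMeasurable
      ((hTf.comp_aestronglyMeasurable hz).prodMk (hy.memLp_grad h).1)
  have hmul0 : ∀ {a : ℕ → ENNReal}, Tendsto a atTop (𝓝 0) →
      Tendsto (fun n => ENNReal.ofReal C * a n) atTop (𝓝 0) := fun ha => by
    simpa using ENNReal.Tendsto.const_mul ha (Or.inr ENNReal.ofReal_ne_top)
  refine hasGradH10_of_tendsto (v := fun n x => T (η n x)) (fun n => hasGradH10_of_contDiff_one
      (hT.comp (h1 n).contDiff_one) ((h1 n).hasCompactSupport.comp_left hT0) hΩ ?_)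
      (hT.continuous.comp_aestronglyMeasurable hy.memLp.1) (fun h => hmT h hy.memLp.1) ?_ ?_
  · have hsub : Function.support (fun x => T (η n x)) ⊆ Function.support (η n) := by
      intro x hx h0
      exact hx (by simp only [h0, hT0])
    exact (closure_mono hsub).trans (h1 n).tsupport_subset
  · refine tendsto_of_tendsto_of_tendsto_of_le_of_le tendsto_const_nhds (hmul0 h2)
      (fun _ => zero_le) fun n => ?_
    exact eLpNorm_le_mul_eLpNorm_of_ae_le_mul (Eventually.of_forall fun x => hLip _ _) 2
  · intro h
    -- The error is split as `T'(η_n)(∂η_n - Dy) + (T'(η_n) - T'(y)) Dy`. This handles the second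
    -- term by dominated convergence; the bound on `T'` handles the first.
    have hdom := (tendsto_eLpNorm_two_of_dominated (μ := volume.restrict Ω)
      (f := fun n x => fderiv ℝ T (η n x) (Dy h x)) (g := fun x => fderiv ℝ T (y x) (Dy h x))
      (b := fun x => C * ‖Dy h x‖) (fun n => hmT h (hmeasη n))
      ((hy.memLp_grad h).norm.const_mul C)
      (fun n => Eventually.of_forall fun x =>
        ((fderiv ℝ T (η n x)).le_opNorm _).trans (by gcongr; exact hC _))
      (by
        filter_upwards [h4] with x hx
        exact (happ.tendsto (fderiv ℝ T (y x), Dy h x)).comp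
          (((hTf.tendsto _).comp hx).prodMk_nhds tendsto_const_nhds))).2
    have hs := (hmul0 (h3 h)).add hdom
    rw [add_zero] at hs
    refine tendsto_of_tendsto_of_tendsto_of_le_of_le tendsto_const_nhds hs
      (fun _ => zero_le) fun n => ?_
    have hm1 : AEStronglyMeasurable (fun x => fderiv ℝ T (η n x) (partialDeriv h (η n) x))
        (volume.restrict Ω) :=
      (happ.comp ((hTf.comp (h1 n).contDiff.continuous).prodMk
        (continuous_partialDeriv (h1 n).contDiff_one h))).aestronglyMeasurable
    have := eLpNorm_add_le (hm1.sub (hmT h (hmeasη n)))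
      ((hmT h (hmeasη n)).sub (hmT h hy.memLp.1)) (p := 2) (by norm_num)
    rw [sub_add_sub_cancel] at this
    simp only [hpd]
    refine this.trans (add_le_add ?_ le_rfl)
    refine eLpNorm_le_mul_eLpNorm_of_ae_le_mul (Eventually.of_forall fun x => ?_) 2
    rw [Pi.sub_apply, ← map_sub]
    exact ((fderiv ℝ T (η n x)).le_opNorm _).trans (by gcongr; exact hC _)

theorem tendsto_setIntegral_smul {f : ℕ → E → F} {g : E → F} {ψ : E → ℝ} (hψ : Continuous ψ)
    (hc : HasCompactSupport ψ) (hf : ∀ n, MemLp (f n) 2 (volume.restrict Ω))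
    (hg : MemLp g 2 (volume.restrict Ω))
    (h : Tendsto (fun n => eLpNorm (fun x => f n x - g x) 2 (volume.restrict Ω)) atTop (𝓝 0)) :
    Tendsto (fun n => ∫ x in Ω, ψ x • f n x) atTop (𝓝 (∫ x in Ω, ψ x • g x)) := by
  have hψm : MemLp ψ 2 (volume.restrict Ω) := hψ.memLp_of_hasCompactSupport hc
  have hint : ∀ {k : E → F}, MemLp k 2 (volume.restrict Ω) →
      Integrable (fun x => ψ x • k x) (volume.restrict Ω) := fun hk =>
    memLp_one_iff_integrable.1 (hk.smul hψm)
  refine tendsto_integral_of_L1 _ (hint hg).1 (Eventually.of_forall fun n => hint (hf n)) ?_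
  have h0 : Tendsto (fun n => eLpNorm ψ 2 (volume.restrict Ω) *
      eLpNorm (fun x => f n x - g x) 2 (volume.restrict Ω)) atTop (𝓝 0) := by
    simpa using ENNReal.Tendsto.const_mul h (Or.inr hψm.2.ne)
  refine tendsto_of_tendsto_of_tendsto_of_le_of_le tendsto_const_nhds h0
    (fun _ => zero_le) fun n => ?_
  have := eLpNorm_smul_le_mul_eLpNorm (p := 2) (q := 2) (r := 1) ((hf n).1.sub hg.1) hψm.1
  rw [eLpNorm_one_eq_lintegral_enorm] at this
  refine le_trans (le_of_eq ?_) this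
  refine lintegral_congr fun x => ?_
  simp [smul_sub]

/-- Integration by parts holds for the approximating test fields, and both sides pass to the `L²`
limit. -/
theorem HasGradH10.integral_smul_grad {u : E → F} {G : Fin N → E → F} (hu : HasGradH10 Ω u G)
    {ψ : E → ℝ} (hψ : ContDiff ℝ ∞ ψ) (hc : HasCompactSupport ψ) (hs : tsupport ψ ⊆ Ω)
    (h : Fin N) : ∫ x in Ω, ψ x • G h x =
      -∫ x in Ω, (fderiv ℝ ψ x (EuclideanSpace.single h 1)) • u x := by
  obtain ⟨η, h1, h2, h3⟩ := hu.approx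
  have hψ1 : ContDiff ℝ 1 ψ := hψ.of_le (by simp)
  have hψ'c : Continuous fun x => fderiv ℝ ψ x (EuclideanSpace.single h 1) :=
    (hψ1.continuous_fderiv (by norm_num)).clm_apply continuous_const
  have hψ's : HasCompactSupport fun x => fderiv ℝ ψ x (EuclideanSpace.single h 1) :=
    hc.fderiv_apply ℝ _
  have hηm : ∀ n, MemLp (η n) 2 (volume.restrict Ω) := fun n =>
    (h1 n).contDiff.continuous.memLp_of_hasCompactSupport (h1 n).hasCompactSupport
  have hη'm : ∀ n, MemLp (partialDeriv h (η n)) 2 (volume.restrict Ω) := fun n =>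
    (continuous_partialDeriv (h1 n).contDiff_one h).memLp_of_hasCompactSupport
      (hasCompactSupport_partialDeriv (h1 n).hasCompactSupport h)
  have L1 := tendsto_setIntegral_smul hψ1.continuous hc hη'm (hu.memLp_grad h) (h3 h)
  have L2 := (tendsto_setIntegral_smul hψ'c hψ's hηm hu.memLp h2).neg
  refine tendsto_nhds_unique L1 (L2.congr fun n => ?_)
  have hset : ∀ {k : E → F}, Function.support k ⊆ tsupport ψ →
      ∫ x in Ω, k x = ∫ x, k x := fun hk => by
    refine setIntegral_eq_integral_of_forall_compl_eq_zero fun x hx => ?_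
    by_contra hne
    exact hx (hs (hk hne))
  rw [hset, hset]
  · symm
    refine integral_smul_fderiv_eq_neg_fderiv_smul_of_integrable ?_ ?_ ?_
      (fun x _ => hψ1.differentiable (by norm_num) x)
      (fun x _ => (h1 n).contDiff_one.differentiable (by norm_num) x)
    · exact (hψ'c.smul (h1 n).contDiff.continuous).integrable_of_hasCompactSupport
        hψ's.smul_right
    · exact (hψ1.continuous.smul (continuous_partialDeriv (h1 n).contDiff_one
        h)).integrable_of_hasCompactSupport hc.smul_right
    · exact (hψ1.continuous.smul (h1 n).contDiff.continuous).integrable_of_hasCompactSupport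
        hc.smul_right
  · exact fun x hx => subset_tsupport _ fun h0 => hx (by simp [h0])
  · refine fun x hx => ?_
    by_contra h0
    apply hx
    simp [(notMem_tsupport_iff_eventuallyEq.1 h0).fderiv_eq]

/-- The gradient of an element of `H̊¹(Ω)` is determined up to null sets. -/
theorem HasGradH10.grad_unique {u : E → F} {G H : Fin N → E → F} (hΩ : IsOpen Ω)
    (hG : HasGradH10 Ω u G) (hH : HasGradH10 Ω u H) (h : Fin N) :
    G h =ᵐ[volume.restrict Ω] H h := by
  have hsub := (hG.memLp_grad h).sub (hH.memLp_grad h)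
  have hloc : LocallyIntegrableOn (fun x => G h x - H h x) Ω volume := by
    have := (hsub.locallyIntegrable (by norm_num))
    rw [locallyIntegrableOn_iff hΩ.isLocallyClosed]
    intro k hk hkc
    have h1 := this.integrableOn_isCompact hkc
    rw [IntegrableOn, Measure.restrict_restrict hkc.measurableSet,
      inter_eq_self_of_subset_left hk] at h1
    exact h1
  have := hΩ.ae_eq_zero_of_integral_contDiff_smul_eq_zero hloc fun ψ hψ hc hs => by
    have hψm : MemLp ψ 2 (volume.restrict Ω) := hψ.continuous.memLp_of_hasCompactSupport hc
    have hint : ∀ {k : E → F}, MemLp k 2 (volume.restrict Ω) →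
        Integrable (fun x => ψ x • k x) (volume.restrict Ω) := fun hk =>
      memLp_one_iff_integrable.1 (hk.smul hψm)
    rw [← setIntegral_eq_integral_of_forall_compl_eq_zero (s := Ω)]
    · simp only [smul_sub]
      rw [integral_sub (hint (hG.memLp_grad h)) (hint (hH.memLp_grad h)),
        hG.integral_smul_grad hψ hc hs, hH.integral_smul_grad hψ hc hs, sub_self]
    · intro x hx
      rw [image_eq_zero_of_notMem_tsupport fun h' => hx (hs h'), zero_smul]
  rw [Filter.EventuallyEq, ae_restrict_iff' hΩ.measurableSet]
  filter_upwards [this] with x hx hxΩ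
  exact sub_eq_zero.1 (hx hxΩ)

end

/-! ### Radial maps and approximation of their profiles. -/

/-- The differential of the radial map `ξ ↦ a(|ξ|) ξ` at `ξ ≠ 0`, applied to `X`. -/
noncomputable def radialDeriv {V : Type*} [NormedAddCommGroup V] [InnerProductSpace ℝ V] (a : ℝ → ℝ)
    (ξ X : V) : V :=
  a ‖ξ‖ • X + (deriv a ‖ξ‖ * (inner ℝ ξ X / ‖ξ‖)) • ξ

section
variable {V : Type*} [NormedAddCommGroup V] [InnerProductSpace ℝ V]

theorem norm_radialDeriv_le {a : ℝ → ℝ} {L : ℝ} {ξ : V} (h1 : |a ‖ξ‖| ≤ L)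
    (h2 : |‖ξ‖ * deriv a ‖ξ‖| ≤ L) (X : V) : ‖radialDeriv a ξ X‖ ≤ 2 * L * ‖X‖ := by
  have hL : 0 ≤ L := (abs_nonneg _).trans h1
  have e1 : ‖a ‖ξ‖ • X‖ ≤ L * ‖X‖ := by
    rw [norm_smul]
    exact mul_le_mul_of_nonneg_right h1 (norm_nonneg _)
  have e2 : ‖(deriv a ‖ξ‖ * (inner ℝ ξ X / ‖ξ‖)) • ξ‖ ≤ L * ‖X‖ := by
    have hi : |inner ℝ ξ X / ‖ξ‖| ≤ ‖X‖ := by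
      rw [abs_div, abs_norm]
      exact div_le_of_le_mul₀ (norm_nonneg _) (norm_nonneg _)
        ((abs_real_inner_le_norm ξ X).trans (by rw [mul_comm]))
    rw [norm_smul, Real.norm_eq_abs, abs_mul]
    calc |deriv a ‖ξ‖| * |inner ℝ ξ X / ‖ξ‖| * ‖ξ‖
        = |‖ξ‖ * deriv a ‖ξ‖| * |inner ℝ ξ X / ‖ξ‖| := by rw [abs_mul, abs_norm]; ring
      _ ≤ L * ‖X‖ := mul_le_mul h2 hi (abs_nonneg _) hL
  have := norm_add_le (a ‖ξ‖ • X) ((deriv a ‖ξ‖ * (inner ℝ ξ X / ‖ξ‖)) • ξ)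
  unfold radialDeriv
  linarith

theorem fderiv_radial_smul {a : ℝ → ℝ} {ξ : V} (hξ : ξ ≠ 0)
    (ha : DifferentiableAt ℝ a ‖ξ‖) (X : V) :
    fderiv ℝ (fun ξ : V => a ‖ξ‖ • ξ) ξ X = radialDeriv a ξ X := by
  have hn : HasFDerivAt (fun ξ : V => ‖ξ‖) (‖ξ‖⁻¹ • innerSL ℝ ξ) ξ := by
    have h1 : HasFDerivAt (fun ξ : V => Real.sqrt (‖ξ‖ ^ 2)) _ ξ :=
      (hasStrictFDerivAt_norm_sq ξ).hasFDerivAt.sqrt (by positivity)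
    simp only [Real.sqrt_sq (norm_nonneg _)] at h1
    refine h1.congr_fderiv ?_
    ext Y
    simp
    field_simp
  have := (ha.hasDerivAt.comp_hasFDerivAt ξ hn).smul (hasFDerivAt_id ξ)
  have h2 := this.fderiv
  simp only [id, Function.comp_def, Pi.smul_def'] at h2
  rw [h2]
  simp [radialDeriv, div_eq_inv_mul]

theorem contDiff_norm_smul {b : ℝ → ℝ} (hb : ContDiff ℝ 1 b) {δ : ℝ} (hδ : 0 < δ)
    (h0 : ∀ t < δ, b t = 0) : ContDiff ℝ 1 (fun ξ : V => b ‖ξ‖ • ξ) := by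
  rw [contDiff_iff_contDiffAt]
  intro ξ
  by_cases hξ : ξ = 0
  · have : (fun ξ : V => b ‖ξ‖ • ξ) =ᶠ[𝓝 ξ] fun _ => 0 := by
      rw [hξ]
      filter_upwards [Metric.ball_mem_nhds (0 : V) hδ] with z hz
      rw [h0 _ (by simpa using hz), zero_smul]
    exact contDiffAt_const.congr_of_eventuallyEq this
  · exact (hb.contDiffAt.comp ξ (contDiffAt_norm ℝ hξ)).smul contDiffAt_id

theorem fderiv_norm_smul_of_eq_zero {b : ℝ → ℝ} (hb : ContDiff ℝ 1 b) {δ : ℝ} (hδ : 0 < δ)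
    (h0 : ∀ t < δ, b t = 0) (ξ X : V) :
    fderiv ℝ (fun ξ : V => b ‖ξ‖ • ξ) ξ X = radialDeriv b ξ X := by
  by_cases hξ : ξ = 0
  · have : (fun ξ : V => b ‖ξ‖ • ξ) =ᶠ[𝓝 ξ] fun _ => 0 := by
      rw [hξ]
      filter_upwards [Metric.ball_mem_nhds (0 : V) hδ] with z hz
      rw [h0 _ (by simpa using hz), zero_smul]
    rw [this.fderiv_eq]
    simp [radialDeriv, hξ, h0 0 hδ]
  · exact fderiv_radial_smul hξ (hb.differentiable (by norm_num) _) X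

end

/-- The bound is put on `t χ'(t)` because this quantity is invariant under rescaling of the
argument. -/
theorem exists_cutoff : ∃ χ : ℝ → ℝ, ContDiff ℝ 1 χ ∧ (∀ t, |χ t| ≤ 1) ∧
    (∀ t < 1 / 2, χ t = 0) ∧ (∀ t, 1 < t → χ t = 1) ∧ ∃ M, 0 ≤ M ∧ ∀ t, |t * deriv χ t| ≤ M := by
  let χ : ℝ → ℝ := fun t => Real.smoothTransition (2 * t - 1)
  have hχ : ContDiff ℝ 1 χ := Real.smoothTransition.contDiff.comp (by fun_prop)
  have h0 : ∀ t < 1 / 2, χ t = 0 := fun t ht =>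
    Real.smoothTransition.zero_of_nonpos (by linarith)
  have h1 : ∀ t, 1 < t → χ t = 1 := fun t ht =>
    Real.smoothTransition.one_of_one_le (by linarith)
  refine ⟨χ, hχ, fun t => abs_le.2 ⟨?_, Real.smoothTransition.le_one _⟩, h0, h1, ?_⟩
  · linarith [Real.smoothTransition.nonneg (2 * t - 1)]
  · have hcont : Continuous fun t => t * deriv χ t :=
      continuous_id.mul (hχ.continuous_deriv (by norm_num))
    have hsupp : HasCompactSupport fun t => t * deriv χ t := by
      refine HasCompactSupport.intro (isCompact_Icc (a := 0) (b := 1)) fun t ht => ?_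
      have : deriv χ t = 0 := by
        rw [mem_Icc, not_and_or, not_le, not_le] at ht
        rcases ht with ht | ht
        · have : χ =ᶠ[𝓝 t] fun _ => 0 := by
            filter_upwards [gt_mem_nhds (show t < 1 / 2 by linarith)] with z hz using h0 z hz
          rw [this.deriv_eq, deriv_const]
        · have : χ =ᶠ[𝓝 t] fun _ => 1 := by
            filter_upwards [lt_mem_nhds ht] with z hz using h1 z hz
          rw [this.deriv_eq, deriv_const]
      rw [this, mul_zero]
    obtain ⟨M, hM⟩ := hcont.bounded_above_of_compact_support hsupp
    exact ⟨M, (norm_nonneg _).trans (hM 0), hM⟩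

/-- A bounded radial profile is the limit of profiles that vanish near the origin. -/
theorem exists_profile_approx {a : ℝ → ℝ} (ha : ContDiffOn ℝ 1 a (Ioi 0)) {L : ℝ}
    (h1 : ∀ t, 0 < t → |a t| ≤ L) (h2 : ∀ t, 0 < t → |t * deriv a t| ≤ L) :
    ∃ (b : ℕ → ℝ → ℝ) (L' : ℝ), (∀ n, ContDiff ℝ 1 (b n)) ∧
      (∀ n, ∃ δ > 0, ∀ t < δ, b n t = 0) ∧ (∀ n t, |b n t| ≤ L') ∧
      (∀ n t, |t * deriv (b n) t| ≤ L') ∧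
      ∀ t, 0 < t → ∀ᶠ n in atTop, b n t = a t ∧ deriv (b n) t = deriv a t := by
  obtain ⟨χ, hχ, hχ1, hχ0, hχone, M, hM0, hM⟩ := exists_cutoff
  have hL : 0 ≤ L := (abs_nonneg _).trans (h1 1 one_pos)
  have hpos : ∀ n : ℕ, (0 : ℝ) < n + 1 := fun n => by positivity
  -- The cut-off factor is `0` below `1/(2(n+1))` and `1` above `1/(n+1)`, so at each `t > 0` the
  -- profile and its derivative are eventually those of `a`.
  let b : ℕ → ℝ → ℝ := fun n t => a t * χ ((n + 1) * t)
  have hδ : ∀ n : ℕ, ∀ t < 1 / (2 * ((n : ℝ) + 1)), b n t = 0 := fun n t ht => by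
    have : ((n : ℝ) + 1) * t < 1 / 2 := by
      rw [lt_div_iff₀ (by have := hpos n; positivity)] at ht
      linarith
    simp only [b, hχ0 _ this, mul_zero]
  have hδ0 : ∀ n : ℕ, 0 < 1 / (2 * ((n : ℝ) + 1)) := fun n => by positivity
  have hat : ∀ t, 0 < t → ContDiffAt ℝ 1 a t := fun t ht => ha.contDiffAt (Ioi_mem_nhds ht)
  have hloc : ∀ n t, t ≤ 0 → b n =ᶠ[𝓝 t] fun _ => 0 := fun n t ht => by
    filter_upwards [gt_mem_nhds (ht.trans_lt (hδ0 n))] with z hz using hδ n z hz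
  have hsc : ∀ n : ℕ, ContDiff ℝ 1 fun t : ℝ => χ ((n + 1) * t) := fun n =>
    hχ.comp (by fun_prop)
  refine ⟨b, L + L * M, fun n => ?_, fun n => ⟨_, hδ0 n, hδ n⟩, fun n t => ?_, fun n t => ?_,
    fun t ht => ?_⟩
  · rw [contDiff_iff_contDiffAt]
    intro t
    rcases le_or_gt t 0 with ht | ht
    · exact contDiffAt_const.congr_of_eventuallyEq (hloc n t ht)
    · exact (hat t ht).mul (hsc n).contDiffAt
  · have hLM : 0 ≤ L * M := mul_nonneg hL hM0
    rcases le_or_gt t 0 with ht | ht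
    · rw [hδ n t (ht.trans_lt (hδ0 n)), abs_zero]
      positivity
    · simp only [b, abs_mul]
      have := mul_le_mul (h1 t ht) (hχ1 ((n + 1) * t)) (abs_nonneg _) hL
      linarith
  · have hLM : 0 ≤ L * M := mul_nonneg hL hM0
    rcases le_or_gt t 0 with ht | ht
    · rw [(hloc n t ht).deriv_eq, deriv_const, mul_zero, abs_zero]
      positivity
    · have hd1 : HasDerivAt (fun t : ℝ => ((n : ℝ) + 1) * t) ((n : ℝ) + 1) t := by
        simpa using (hasDerivAt_id t).const_mul ((n : ℝ) + 1)
      have hd2 : HasDerivAt (fun t : ℝ => χ ((n + 1) * t)) _ t :=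
        ((hχ.differentiable (by norm_num) ((n + 1) * t)).hasDerivAt).comp t hd1
      have hd : HasDerivAt (b n) _ t :=
        (((hat t ht).differentiableAt (by norm_num)).hasDerivAt).mul hd2
      rw [hd.deriv]
      -- The factor `n + 1` from the chain rule is absorbed into the rescaled argument, which makes
      -- the bound uniform in `n`.
      have e : t * (deriv a t * χ ((n + 1) * t) + a t * (deriv χ ((n + 1) * t) * (n + 1))) =
          (t * deriv a t) * χ ((n + 1) * t) +
            a t * (((n + 1) * t) * deriv χ ((n + 1) * t)) := by ring
      rw [e]
      refine (abs_add_le _ _).trans ?_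
      rw [abs_mul, abs_mul (a t)]
      have i1 := mul_le_mul (h2 t ht) (hχ1 ((n + 1) * t)) (abs_nonneg _) hL
      have i2 := mul_le_mul (h1 t ht) (hM ((n + 1) * t)) (abs_nonneg _) hL
      linarith
  · obtain ⟨n₀, hn₀⟩ := exists_nat_gt (1 / t)
    filter_upwards [eventually_ge_atTop n₀] with n hn
    have hlt : 1 / ((n : ℝ) + 1) < t := by
      rw [div_lt_iff₀ ht] at hn₀
      rw [div_lt_iff₀ (hpos n)]
      have : (n₀ : ℝ) ≤ n := by exact_mod_cast hn
      nlinarith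
    have heq : b n =ᶠ[𝓝 t] a := by
      filter_upwards [lt_mem_nhds hlt] with z hz
      have : 1 < ((n : ℝ) + 1) * z := by
        rw [div_lt_iff₀ (hpos n)] at hz
        linarith
      simp only [b, hχone _ this, mul_one]
    exact ⟨heq.self_of_nhds, heq.deriv_eq⟩

/-! ### The chain rule for radial maps with bounded profile. -/

section
variable {N m : ℕ} {Ω : Set (EuclideanSpace ℝ (Fin N))}

local notation "E" => EuclideanSpace ℝ (Fin N)
local notation "F" => EuclideanSpace ℂ (Fin m)

-- The approximating profiles vanish near the origin, so their gradients vanish wherever `y = 0`,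
-- and so does the limit. Whether `Dy` itself vanishes there is not yet known, hence the case
-- distinction.
open Classical in
theorem HasGradH10.radial_aux {y : E → F} {Dy : Fin N → E → F} (hy : HasGradH10 Ω y Dy)
    (hΩ : IsOpen Ω) {a : ℝ → ℝ} (ha : ContDiffOn ℝ 1 a (Ioi 0)) {L : ℝ}
    (h1 : ∀ t, 0 < t → |a t| ≤ L) (h2 : ∀ t, 0 < t → |t * deriv a t| ≤ L) :
    HasGradH10 Ω (fun x => a ‖y x‖ • y x)
      (fun h x => if y x = 0 then 0 else radialDeriv a (y x) (Dy h x)) := by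
  obtain ⟨b, L', hb, hδ, hb1, hb2, hlim⟩ := exists_profile_approx ha h1 h2
  have hgrad : ∀ n (ξ X : F), fderiv ℝ (fun ξ : F => b n ‖ξ‖ • ξ) ξ X = radialDeriv (b n) ξ X :=
    fun n ξ X => by
      obtain ⟨δ, hδ1, hδ2⟩ := hδ n
      exact fderiv_norm_smul_of_eq_zero (hb n) hδ1 hδ2 ξ X
  have hL' : 0 ≤ L' := (abs_nonneg _).trans (hb1 0 0)
  have H : ∀ n, HasGradH10 Ω (fun x => b n ‖y x‖ • y x)
      (fun h x => radialDeriv (b n) (y x) (Dy h x)) := fun n => by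
    obtain ⟨δ, hδ1, hδ2⟩ := hδ n
    have := hy.comp_contDiff hΩ (T := fun ξ : F => b n ‖ξ‖ • ξ)
      (contDiff_norm_smul (hb n) hδ1 hδ2) (by simp) (C := 2 * L') fun ξ =>
        ContinuousLinearMap.opNorm_le_bound _ (by positivity) fun X => by
          rw [hgrad]
          exact norm_radialDeriv_le (hb1 n _) (hb2 n _) X
    simpa only [hgrad] using this
  have K1 := tendsto_eLpNorm_two_of_dominated (μ := volume.restrict Ω)
    (f := fun n x => b n ‖y x‖ • y x) (g := fun x => a ‖y x‖ • y x) (b := fun x => L' * ‖y x‖)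
    (fun n => (H n).memLp.1) (hy.memLp.norm.const_mul L')
    (fun n => Eventually.of_forall fun x => by
      rw [norm_smul]
      exact mul_le_mul_of_nonneg_right (hb1 n _) (norm_nonneg _))
    (Eventually.of_forall fun x => by
      by_cases hx : y x = 0
      · simp [hx]
      · refine tendsto_const_nhds.congr' ?_
        filter_upwards [hlim _ (norm_pos_iff.2 hx)] with n hn
        rw [hn.1])
  have K2 := fun h => tendsto_eLpNorm_two_of_dominated (μ := volume.restrict Ω)
    (f := fun n x => radialDeriv (b n) (y x) (Dy h x))
    (g := fun x => if y x = 0 then 0 else radialDeriv a (y x) (Dy h x))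
    (b := fun x => 2 * L' * ‖Dy h x‖)
    (fun n => ((H n).memLp_grad h).1) ((hy.memLp_grad h).norm.const_mul _)
    (fun n => Eventually.of_forall fun x => norm_radialDeriv_le (hb1 n _) (hb2 n _) _)
    (Eventually.of_forall fun x => by
      by_cases hx : y x = 0
      · have : ∀ n, b n 0 = 0 := fun n => by
          obtain ⟨δ, hδ1, hδ2⟩ := hδ n
          exact hδ2 0 hδ1
        simp [hx, radialDeriv, this]
      · refine tendsto_const_nhds.congr' ?_
        filter_upwards [hlim _ (norm_pos_iff.2 hx)] with n hn
        rw [if_neg hx, radialDeriv, radialDeriv, hn.1, hn.2])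
  exact hasGradH10_of_tendsto H K1.1.1 (fun h => (K2 h).1.1) K1.2 fun h => (K2 h).2

/-- With the profile `1` the radial map is the identity, so `radial_aux` yields a second gradient of
`y`, one that vanishes on `{y = 0}`; gradients are unique. -/
theorem HasGradH10.grad_eq_zero {y : E → F} {Dy : Fin N → E → F} (hy : HasGradH10 Ω y Dy)
    (hΩ : IsOpen Ω) (h : Fin N) : ∀ᵐ x ∂(volume.restrict Ω), y x = 0 → Dy h x = 0 := by
  classical
  have := hy.radial_aux hΩ (a := fun _ => 1) contDiffOn_const (L := 1) (by simp) (by simp)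
  simp only [one_smul] at this
  filter_upwards [hy.grad_unique hΩ this h] with x hx h0
  rw [hx, if_pos h0]

/-- Chain rule in `H̊¹` for the radial map `ξ ↦ a(|ξ|) ξ`. -/
theorem HasGradH10.radial {y : E → F} {Dy : Fin N → E → F} (hy : HasGradH10 Ω y Dy)
    (hΩ : IsOpen Ω) {a : ℝ → ℝ} (ha : ContDiffOn ℝ 1 a (Ioi 0)) {L : ℝ}
    (h1 : ∀ t, 0 < t → |a t| ≤ L) (h2 : ∀ t, 0 < t → |t * deriv a t| ≤ L) :
    HasGradH10 Ω (fun x => a ‖y x‖ • y x) (fun h x => radialDeriv a (y x) (Dy h x)) := by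
  classical
  refine (hy.radial_aux hΩ ha h1 h2).congr_grad fun h => ?_
  filter_upwards [hy.grad_eq_zero hΩ h] with x hx
  split_ifs with h0
  · simp [radialDeriv, hx h0, h0]
  · rfl

end

/-! ### Increasing `C¹` bijections of the half-line and their inverses. -/

theorem image_Ioi_eq_Ioi {f : ℝ → ℝ} (hf : ContinuousOn f (Ioi 0)) (hpos : ∀ s, 0 < s → 0 < f s)
    (hlo : ∀ T, 0 < T → ∃ s, 0 < s ∧ f s ≤ T) (hhi : ∀ T, 0 < T → ∃ s, 0 < s ∧ T ≤ f s) :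
    f '' Ioi 0 = Ioi 0 := by
  refine Subset.antisymm (image_subset_iff.2 fun s hs => hpos s hs) fun T hT => ?_
  obtain ⟨s, hs, h1⟩ := hlo T hT
  obtain ⟨s', hs', h2⟩ := hhi T hT
  exact isPreconnected_Ioi.intermediate_value (mem_Ioi.2 hs) (mem_Ioi.2 hs') hf ⟨h1, h2⟩

section
variable {f : ℝ → ℝ} (hf : ContDiffOn ℝ 1 f (Ioi 0)) (hd : ∀ s, 0 < s → 0 < deriv f s)
include hf hd

theorem strictMonoOn_Ioi_of_contDiffOn : StrictMonoOn f (Ioi 0) :=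
  strictMonoOn_of_deriv_pos (convex_Ioi 0) hf.continuousOn fun s hs => by
    rw [interior_Ioi] at hs
    exact hd s hs

theorem invFunOn_Ioi_apply {s : ℝ} (hs : 0 < s) : Function.invFunOn f (Ioi 0) (f s) = s :=
  (strictMonoOn_Ioi_of_contDiffOn hf hd).injOn.leftInvOn_invFunOn hs

theorem hasDerivAt_invFunOn_Ioi {s : ℝ} (hs : 0 < s) :
    HasDerivAt (Function.invFunOn f (Ioi 0)) (deriv f s)⁻¹ (f s) := by
  have h1 : HasStrictDerivAt f (deriv f s) s :=
    (hf.contDiffAt (Ioi_mem_nhds hs)).hasStrictDerivAt (by norm_num)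
  refine (h1.to_local_left_inverse (hd s hs).ne' ?_).hasDerivAt
  filter_upwards [Ioi_mem_nhds hs] with x hx using invFunOn_Ioi_apply hf hd hx

theorem contDiffOn_invFunOn_Ioi (hi : f '' Ioi 0 = Ioi 0) :
    ContDiffOn ℝ 1 (Function.invFunOn f (Ioi 0)) (Ioi 0) := by
  have hrep : ∀ t, 0 < t → ∃ s, 0 < s ∧ f s = t := fun t ht => by
    have : t ∈ f '' Ioi 0 := by rw [hi]; exact ht
    exact this
  have hder : ∀ t, 0 < t → HasDerivAt (Function.invFunOn f (Ioi 0))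
      (deriv f (Function.invFunOn f (Ioi 0) t))⁻¹ t := by
    intro t ht
    obtain ⟨s, hs, rfl⟩ := hrep t ht
    rw [invFunOn_Ioi_apply hf hd hs]
    exact hasDerivAt_invFunOn_Ioi hf hd hs
  have hmaps : ∀ t, 0 < t → 0 < Function.invFunOn f (Ioi 0) t := fun t ht => by
    obtain ⟨s, hs, rfl⟩ := hrep t ht
    rwa [invFunOn_Ioi_apply hf hd hs]
  have hcont : ContinuousOn (Function.invFunOn f (Ioi 0)) (Ioi 0) := fun t ht =>
    (hder t ht).continuousAt.continuousWithinAt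
  rw [show (1 : WithTop ℕ∞) = 0 + 1 by simp, contDiffOn_succ_iff_deriv_of_isOpen isOpen_Ioi]
  refine ⟨fun t ht => (hder t ht).differentiableAt.differentiableWithinAt, by simp, ?_⟩
  rw [contDiffOn_zero]
  have h2 : ContinuousOn (deriv f) (Ioi 0) := hf.continuousOn_deriv_of_isOpen isOpen_Ioi (by simp)
  refine ((h2.comp hcont fun t ht => hmaps t ht).inv₀ fun t ht => (hd _ (hmaps t ht)).ne').congr
    fun t ht => (hder t ht).deriv

end

/-! ### The weight: meaning of `Λ_∞²` and the bounded profiles. -/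

theorem weightLambdaInftySq_nonneg (φ : ℝ → ℝ) : 0 ≤ weightLambdaInftySq φ :=
  Real.sSup_nonneg (by rintro _ ⟨t, _, rfl⟩; positivity)

namespace AdmissibleWeight
variable {φ : ℝ → ℝ} (hφ : AdmissibleWeight φ)
include hφ

theorem contDiffAt {s : ℝ} (hs : 0 < s) : ContDiffAt ℝ 1 φ s :=
  hφ.contDiffOn.contDiffAt (Ioi_mem_nhds hs)

theorem hasDerivAt {s : ℝ} (hs : 0 < s) : HasDerivAt φ (deriv φ s) s :=
  ((hφ.contDiffAt hs).differentiableAt (by norm_num)).hasDerivAt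

theorem deriv_id_mul {s : ℝ} (hs : 0 < s) :
    deriv (fun t => t * φ t) s = φ s + s * deriv φ s := by
  have h : HasDerivAt (fun t => t * φ t) _ s := (hasDerivAt_id' s).mul (hφ.hasDerivAt hs)
  rw [h.deriv, one_mul]

theorem contDiffOn_sqrt : ContDiffOn ℝ 1 (fun s => Real.sqrt (φ s)) (Ioi 0) :=
  hφ.contDiffOn.sqrt fun s hs => (hφ.pos s hs).ne'

theorem hasDerivAt_mul_sqrt {s : ℝ} (hs : 0 < s) :
    HasDerivAt (fun s => s * Real.sqrt (φ s))
      ((φ s + deriv (fun t => t * φ t) s) / (2 * Real.sqrt (φ s))) s := by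
  have h := (hasDerivAt_id s).mul ((hφ.hasDerivAt hs).sqrt (hφ.pos s hs).ne')
  refine h.congr_deriv ?_
  have hr : 0 < Real.sqrt (φ s) := Real.sqrt_pos.2 (hφ.pos s hs)
  rw [hφ.deriv_id_mul hs]
  set r := Real.sqrt (φ s) with hrdef
  rw [show φ s = r ^ 2 from (Real.sq_sqrt (hφ.pos s hs).le).symm]
  simp only [id]
  field_simp
  ring

theorem exists_mul_eq {T : ℝ} (hT : 0 < T) : ∃ s, 0 < s ∧ s * φ s = T := by
  have : T ∈ (fun s => s * φ s) '' Ioi 0 := by rw [hφ.range_eq]; exact hT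
  exact this

theorem strictMonoOn_mul : StrictMonoOn (fun s => s * φ s) (Ioi 0) :=
  strictMonoOn_Ioi_of_contDiffOn (contDiffOn_id.mul hφ.contDiffOn) hφ.deriv_pos

/-- The square of `s √φ(s)` is `s · sφ(s)`. If `sφ(s) = T²`, monotonicity of `sφ(s)` makes this
square at most `T²` at `min s 1` and at least `T²` at `max s 1`. -/
theorem image_mul_sqrt : (fun s => s * Real.sqrt (φ s)) '' Ioi 0 = Ioi 0 := by
  have hsq : ∀ s, 0 < s → (s * Real.sqrt (φ s)) ^ 2 = s * (s * φ s) := fun s hs => by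
    rw [mul_pow, Real.sq_sqrt (hφ.pos s hs).le]
    ring
  have hmono := hφ.strictMonoOn_mul.monotoneOn
  refine image_Ioi_eq_Ioi (contDiffOn_id.mul hφ.contDiffOn_sqrt).continuousOn
    (fun s hs => mul_pos hs (Real.sqrt_pos.2 (hφ.pos s hs))) (fun T hT => ?_) fun T hT => ?_
  · obtain ⟨s, hs, h⟩ := hφ.exists_mul_eq (pow_pos hT 2)
    have hm : 0 < min s 1 := lt_min hs one_pos
    refine ⟨min s 1, hm, ?_⟩
    rw [← abs_of_pos hT]
    refine (le_abs_self _).trans (sq_le_sq.1 ?_)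
    rw [hsq _ hm, ← h]
    have h1 := hmono (mem_Ioi.2 hm) (mem_Ioi.2 hs) (min_le_left s 1)
    have h2 := mul_pos hm (hφ.pos _ hm)
    calc _ ≤ 1 * (min s 1 * φ (min s 1)) :=
          mul_le_mul_of_nonneg_right (min_le_right _ _) h2.le
      _ ≤ _ := by rw [one_mul]; exact h1
  · obtain ⟨s, hs, h⟩ := hφ.exists_mul_eq (pow_pos hT 2)
    have hm : 0 < max s 1 := lt_max_of_lt_left hs
    refine ⟨max s 1, hm, ?_⟩
    have hψ : 0 < max s 1 * Real.sqrt (φ (max s 1)) :=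
      mul_pos hm (Real.sqrt_pos.2 (hφ.pos _ hm))
    refine (sq_le_sq₀ hT.le hψ.le).1 ?_
    rw [hsq _ hm, ← h]
    have h1 := hmono (mem_Ioi.2 hs) (mem_Ioi.2 hm) (le_max_left s 1)
    have h2 := mul_pos hm (hφ.pos _ hm)
    calc _ ≤ 1 * (max s 1 * φ (max s 1)) := by rw [one_mul]; exact h1
      _ ≤ _ := mul_le_mul_of_nonneg_right (le_max_right _ _) h2.le

theorem image_add_mul : (fun s => s + s * φ s) '' Ioi 0 = Ioi 0 := by
  have hmono := hφ.strictMonoOn_mul.monotoneOn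
  refine image_Ioi_eq_Ioi (contDiffOn_id.add (contDiffOn_id.mul hφ.contDiffOn)).continuousOn
    (fun s hs => add_pos hs (mul_pos hs (hφ.pos s hs))) (fun T hT => ?_) fun T hT => ?_
  · obtain ⟨s, hs, h⟩ := hφ.exists_mul_eq (half_pos hT)
    have hm : 0 < min s (T / 2) := lt_min hs (half_pos hT)
    refine ⟨min s (T / 2), hm, ?_⟩
    have h1 : min s (T / 2) * φ (min s (T / 2)) ≤ s * φ s :=
      hmono (mem_Ioi.2 hm) (mem_Ioi.2 hs) (min_le_left _ _)
    have := min_le_right s (T / 2)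
    change min s (T / 2) + min s (T / 2) * φ (min s (T / 2)) ≤ T
    linarith
  · obtain ⟨s, hs, h⟩ := hφ.exists_mul_eq hT
    exact ⟨s, hs, by linarith⟩

/-- Parametrising by `s = ζ(t)` removes the inverse function from `Λ` and leaves the ratio of `φ(s)`
and `(sφ(s))'` that the pointwise estimate uses. -/
theorem weightLambda_apply {s : ℝ} (hs : 0 < s) :
    weightLambda φ (s * Real.sqrt (φ s)) =
      (φ s - deriv (fun t => t * φ t) s) / (φ s + deriv (fun t => t * φ t) s) := by
  have hr : 0 < Real.sqrt (φ s) := Real.sqrt_pos.2 (hφ.pos s hs)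
  have hψc : ContDiffOn ℝ 1 (fun s => s * Real.sqrt (φ s)) (Ioi 0) :=
    contDiffOn_id.mul hφ.contDiffOn_sqrt
  have hd : ∀ s, 0 < s → 0 < deriv (fun s => s * Real.sqrt (φ s)) s := fun s hs => by
    rw [(hφ.hasDerivAt_mul_sqrt hs).deriv]
    have := hφ.pos s hs
    have := hφ.deriv_pos s hs
    have : 0 < Real.sqrt (φ s) := Real.sqrt_pos.2 (hφ.pos s hs)
    positivity
  have hp := hφ.deriv_pos s hs
  have hφs := hφ.pos s hs
  have hz : HasDerivAt (weightZeta φ) _ (s * Real.sqrt (φ s)) := hasDerivAt_invFunOn_Ioi hψc hd hs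
  have hzs : weightZeta φ (s * Real.sqrt (φ s)) = s := invFunOn_Ioi_apply hψc hd hs
  have ht : 0 < s * Real.sqrt (φ s) := mul_pos hs hr
  have hΘ : HasDerivAt (weightTheta φ) _ (s * Real.sqrt (φ s)) := hz.div (hasDerivAt_id' _) ht.ne'
  rw [weightLambda, hΘ.deriv, weightTheta, hzs, (hφ.hasDerivAt_mul_sqrt hs).deriv]
  set p := deriv (fun t => t * φ t) s
  set r := Real.sqrt (φ s) with hrdef
  have e : φ s = r ^ 2 := (Real.sq_sqrt hφs.le).symm
  rw [e]
  have : 0 < r ^ 2 + p := by positivity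
  field_simp
  ring

/-- The bound on the weight that `Λ_∞²` expresses; it holds with a true supremum since
`Λ² < 1` throughout. -/
theorem sq_sub_le {s : ℝ} (hs : 0 < s) :
    (φ s - deriv (fun t => t * φ t) s) ^ 2 ≤
      weightLambdaInftySq φ * (φ s + deriv (fun t => t * φ t) s) ^ 2 := by
  have hbdd : BddAbove ((fun t => weightLambda φ t ^ 2) '' Ioi 0) := by
    refine ⟨1, ?_⟩
    rintro _ ⟨t, ht, rfl⟩
    have : t ∈ (fun s => s * Real.sqrt (φ s)) '' Ioi 0 := by rw [hφ.image_mul_sqrt]; exact ht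
    obtain ⟨s, hs, rfl⟩ := this
    have h1 := hφ.pos s hs
    have h2 := hφ.deriv_pos s hs
    simp only
    rw [hφ.weightLambda_apply hs, div_pow, div_le_one (by positivity)]
    nlinarith
  have h := le_csSup hbdd ⟨s * Real.sqrt (φ s),
    mul_pos (mem_Ioi.1 hs) (Real.sqrt_pos.2 (hφ.pos s hs)), rfl⟩
  have h1 := hφ.pos s hs
  have h2 := hφ.deriv_pos s hs
  simp only at h
  rw [hφ.weightLambda_apply hs, div_pow, div_le_iff₀ (by positivity)] at h
  exact h

/-- With `d = Λ_∞ < 1`, the bound `|f - p| ≤ d (f + p)` confines `p / f` between `(1 - d)/(1 + d)`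
and its reciprocal. -/
theorem exists_comparable (hc : weightLambdaInftySq φ < 1) :
    ∃ K : ℝ, 1 ≤ K ∧ ∀ s, 0 < s → deriv (fun t => t * φ t) s ≤ K * φ s ∧
      φ s ≤ K * deriv (fun t => t * φ t) s := by
  set d := Real.sqrt (weightLambdaInftySq φ)
  have hd0 : 0 ≤ d := Real.sqrt_nonneg _
  have hd1 : d < 1 := by rw [Real.sqrt_lt' one_pos]; simpa using hc
  have hd2 : d ^ 2 = weightLambdaInftySq φ := Real.sq_sqrt (weightLambdaInftySq_nonneg φ)
  have hd3 : 0 < 1 - d := by linarith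
  refine ⟨(1 + d) / (1 - d), by rw [le_div_iff₀ hd3]; linarith, fun s hs => ?_⟩
  have h1 := hφ.pos s hs
  have h2 := hφ.deriv_pos s hs
  have h := hφ.sq_sub_le hs
  rw [← hd2, ← mul_pow] at h
  have h3 := abs_le_of_sq_le_sq' h (by positivity)
  constructor
  · rw [div_mul_eq_mul_div, le_div_iff₀ hd3]
    linarith
  · rw [div_mul_eq_mul_div, le_div_iff₀ hd3]
    linarith

/-- With `|y| = s + s φ(s)` the vectors `u` and `√φ(|u|) u` are bounded `C¹` radial functions of
`y = u + φ(|u|) u`. -/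
theorem exists_profiles (hc : weightLambdaInftySq φ < 1) : ∃ (a b : ℝ → ℝ) (L : ℝ),
    (ContDiffOn ℝ 1 a (Ioi 0) ∧ ∀ t, 0 < t → |a t| ≤ L ∧ |t * deriv a t| ≤ L) ∧
    (ContDiffOn ℝ 1 b (Ioi 0) ∧ ∀ t, 0 < t → |b t| ≤ L ∧ |t * deriv b t| ≤ L) ∧
    ∀ s, 0 < s → ∀ t, t = s + s * φ s → a t = 1 / (1 + φ s) ∧ b t = Real.sqrt (φ s) / (1 + φ s) ∧
      a t + t * deriv a t = 1 / (1 + deriv (fun t => t * φ t) s) ∧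
      b t + t * deriv b t = (φ s + deriv (fun t => t * φ t) s) /
        (2 * Real.sqrt (φ s) * (1 + deriv (fun t => t * φ t) s)) := by
  obtain ⟨K, hK1, hK⟩ := hφ.exists_comparable hc
  have hgc : ContDiffOn ℝ 1 (fun s => s + s * φ s) (Ioi 0) :=
    contDiffOn_id.add (contDiffOn_id.mul hφ.contDiffOn)
  have hgd : ∀ s, 0 < s →
      deriv (fun s => s + s * φ s) s = 1 + deriv (fun t => t * φ t) s := fun s hs => by
    have h1 : DifferentiableAt ℝ (fun t => t * φ t) s :=
      ((hasDerivAt_id s).mul (hφ.hasDerivAt hs)).differentiableAt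
    have h2 : HasDerivAt (fun s => s + s * φ s) _ s := (hasDerivAt_id' s).add h1.hasDerivAt
    exact h2.deriv
  have hgpos : ∀ s, 0 < s → 0 < deriv (fun s => s + s * φ s) s := fun s hs => by
    rw [hgd s hs]
    linarith [hφ.deriv_pos s hs]
  set σ := Function.invFunOn (fun s => s + s * φ s) (Ioi 0) with hσ
  have hσc : ContDiffOn ℝ 1 σ (Ioi 0) := contDiffOn_invFunOn_Ioi hgc hgpos hφ.image_add_mul
  have hσs : ∀ s, 0 < s → σ (s + s * φ s) = s := fun s hs => invFunOn_Ioi_apply hgc hgpos hs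
  have hσd : ∀ s, 0 < s → HasDerivAt σ (1 + deriv (fun t => t * φ t) s)⁻¹ (s + s * φ s) :=
    fun s hs => by
      rw [← hgd s hs]
      exact hasDerivAt_invFunOn_Ioi hgc hgpos hs
  have hrep : ∀ t, 0 < t → ∃ s, 0 < s ∧ s + s * φ s = t := fun t ht => by
    have : t ∈ (fun s => s + s * φ s) '' Ioi 0 := by rw [hφ.image_add_mul]; exact ht
    exact this
  have hσm : MapsTo σ (Ioi 0) (Ioi 0) := fun t ht => by
    obtain ⟨s, hs, rfl⟩ := hrep t ht
    rw [hσs s hs]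
    exact hs
  have hAc : ContDiffOn ℝ 1 (fun s => 1 / (1 + φ s)) (Ioi 0) :=
    contDiffOn_const.div (contDiffOn_const.add hφ.contDiffOn) fun s hs => by
      have := hφ.pos s hs
      positivity
  have hBc : ContDiffOn ℝ 1 (fun s => Real.sqrt (φ s) / (1 + φ s)) (Ioi 0) :=
    hφ.contDiffOn_sqrt.div (contDiffOn_const.add hφ.contDiffOn) fun s hs => by
      have := hφ.pos s hs
      positivity
  have hA : ∀ s, 0 < s → 1 / (1 + φ (σ (s + s * φ s))) +
      (s + s * φ s) * deriv (fun t => 1 / (1 + φ (σ t))) (s + s * φ s) =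
        1 / (1 + deriv (fun t => t * φ t) s) := fun s hs => by
    have h1 := hφ.pos s hs
    have h2 := hφ.deriv_pos s hs
    have hd : HasDerivAt (fun s => 1 / (1 + φ s)) _ s :=
      (hasDerivAt_const s 1).div ((hφ.hasDerivAt hs).const_add 1) (by positivity)
    have hd' : HasDerivAt (fun t => 1 / (1 + φ (σ t))) _ (s + s * φ s) :=
      hd.comp_of_eq _ (hσd s hs) (hσs s hs).symm
    rw [hd'.deriv, hσs s hs]
    -- Eliminating `φ'` in favour of `p = (sφ)'` turns the claim into a rational identity in `s`,
    -- `φ(s)` and `p`.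
    have e : deriv φ s = (deriv (fun t => t * φ t) s - φ s) / s := by
      rw [hφ.deriv_id_mul hs]
      field_simp
      ring
    rw [e]
    field_simp
    ring
  have hB : ∀ s, 0 < s → Real.sqrt (φ (σ (s + s * φ s))) / (1 + φ (σ (s + s * φ s))) +
      (s + s * φ s) * deriv (fun t => Real.sqrt (φ (σ t)) / (1 + φ (σ t))) (s + s * φ s) =
        (φ s + deriv (fun t => t * φ t) s) /
        (2 * Real.sqrt (φ s) * (1 + deriv (fun t => t * φ t) s)) := fun s hs => by
    have h1 := hφ.pos s hs
    have h2 := hφ.deriv_pos s hs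
    have hd : HasDerivAt (fun s => Real.sqrt (φ s) / (1 + φ s)) _ s :=
      ((hφ.hasDerivAt hs).sqrt h1.ne').div ((hφ.hasDerivAt hs).const_add 1) (by positivity)
    have hd' : HasDerivAt (fun t => Real.sqrt (φ (σ t)) / (1 + φ (σ t))) _ (s + s * φ s) :=
      hd.comp_of_eq _ (hσd s hs) (hσs s hs).symm
    rw [hd'.deriv, hσs s hs]
    have e : deriv φ s = (deriv (fun t => t * φ t) s - φ s) / s := by
      rw [hφ.deriv_id_mul hs]
      field_simp
      ring
    rw [e]
    set p := deriv (fun t => t * φ t) s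
    set r := Real.sqrt (φ s) with hr
    have hr0 : 0 < r := Real.sqrt_pos.2 h1
    rw [show φ s = r ^ 2 from (Real.sq_sqrt h1.le).symm]
    field_simp
    ring
  have hA1 : ∀ s, 0 < s → |1 / (1 + φ s)| ≤ 1 := fun s hs => by
    have h1 := hφ.pos s hs
    rw [abs_of_pos (by positivity), div_le_one (by positivity)]
    linarith
  have hB1 : ∀ s, 0 < s → |Real.sqrt (φ s) / (1 + φ s)| ≤ 1 := fun s hs => by
    have h1 := hφ.pos s hs
    have hr0 : 0 < Real.sqrt (φ s) := Real.sqrt_pos.2 h1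
    rw [abs_of_pos (by positivity), div_le_one (by positivity)]
    nlinarith [Real.sq_sqrt h1.le, sq_nonneg (Real.sqrt (φ s) - 1)]
  -- Both profiles are at most `1`. Since `a + t a' ≤ 1` and `b + t b' ≤ (1 + K) K`, subtraction
  -- bounds `t a'` and `t b'`; one constant covers all four.
  refine ⟨fun t => 1 / (1 + φ (σ t)), fun t => Real.sqrt (φ (σ t)) / (1 + φ (σ t)),
    2 + (1 + K) * K, ⟨hAc.comp hσc hσm, fun t ht => ?_⟩, ⟨hBc.comp hσc hσm, fun t ht => ?_⟩,
    fun s hs t ht => ?_⟩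
  · obtain ⟨s, hs, rfl⟩ := hrep t ht
    have h3 := hA s hs
    have h2 := hφ.deriv_pos s hs
    have h4 := hA1 s hs
    simp only [hσs s hs] at h3 ⊢
    have h5 : |1 / (1 + deriv (fun t => t * φ t) s)| ≤ 1 := by
      rw [abs_of_pos (by positivity), div_le_one (by positivity)]
      linarith
    have hKK : 0 ≤ (1 + K) * K := by positivity
    refine ⟨by linarith, ?_⟩
    rw [← eq_sub_iff_add_eq'] at h3
    rw [h3]
    refine (abs_sub _ _).trans ?_
    linarith
  · obtain ⟨s, hs, rfl⟩ := hrep t ht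
    have h3 := hB s hs
    have h1 := hφ.pos s hs
    have h2 := hφ.deriv_pos s hs
    have h4 := hB1 s hs
    simp only [hσs s hs] at h3 ⊢
    obtain ⟨k1, k2⟩ := hK s hs
    have h5 : |(φ s + deriv (fun t => t * φ t) s) /
        (2 * Real.sqrt (φ s) * (1 + deriv (fun t => t * φ t) s))| ≤ (1 + K) * K := by
      have hr0 : 0 < Real.sqrt (φ s) := Real.sqrt_pos.2 h1
      rw [abs_of_pos (by positivity), div_le_iff₀ (by positivity)]
      set p := deriv (fun t => t * φ t) s
      set r := Real.sqrt (φ s) with hr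
      have e : φ s = r ^ 2 := (Real.sq_sqrt h1.le).symm
      -- One factor `r = √φ(s)` cancels against the denominator. The other is controlled by `r ≤ 1 +
      -- r² ≤ 1 + K p ≤ K (1 + p)`.
      have i1 : φ s + p ≤ (1 + K) * r ^ 2 := by rw [← e]; linarith
      have i2 : r ≤ K * (2 * (1 + p)) := by
        have : r ≤ 1 + r ^ 2 := by nlinarith [sq_nonneg (r - 1)]
        rw [e] at k2
        nlinarith
      calc φ s + p ≤ (1 + K) * r * r := by rw [mul_assoc, ← sq]; exact i1
        _ ≤ (1 + K) * r * (K * (2 * (1 + p))) := by gcongr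
        _ = _ := by ring
    have hKK : 0 ≤ (1 + K) * K := by positivity
    refine ⟨by linarith, ?_⟩
    rw [← eq_sub_iff_add_eq'] at h3
    rw [h3]
    refine (abs_sub _ _).trans ?_
    linarith
  · subst ht
    exact ⟨by simp only [hσs s hs], by simp only [hσs s hs], hA s hs, hB s hs⟩

end AdmissibleWeight

/-! ### The divergence is bounded in `L²` by the gradient. -/

theorem tendsto_integral_norm_sq {α F : Type*} [MeasurableSpace α] {μ : Measure α}
    [NormedAddCommGroup F] {f : ℕ → α → F} {g : α → F} (hf : ∀ n, MemLp (f n) 2 μ)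
    (hg : MemLp g 2 μ)
    (h : Tendsto (fun n => eLpNorm (fun x => f n x - g x) 2 μ) atTop (𝓝 0)) :
    Tendsto (fun n => ∫ x, ‖f n x‖ ^ 2 ∂μ) atTop (𝓝 (∫ x, ‖g x‖ ^ 2 ∂μ)) := by
  have key : ∀ {k : α → F} (hk : MemLp k 2 μ), ∫ x, ‖k x‖ ^ 2 ∂μ = ‖hk.toLp k‖ ^ 2 := by
    intro k hk
    have hi : 0 ≤ ∫ x, ‖k x‖ ^ 2 ∂μ := integral_nonneg fun x => by positivity
    rw [Lp.norm_toLp, hk.eLpNorm_eq_integral_rpow_norm (by norm_num) (by norm_num)]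
    simp only [ENNReal.toReal_ofNat, Real.rpow_two]
    rw [ENNReal.toReal_ofReal (by positivity), ← Real.rpow_natCast _ 2, ← Real.rpow_mul hi]
    norm_num
  have := (Lp.tendsto_Lp_iff_tendsto_eLpNorm'' f hf g hg).2 h
  rw [key hg]
  simp only [key (hf _)]
  exact this.norm.pow 2

section
variable {N m : ℕ} {Ω : Set (EuclideanSpace ℝ (Fin N))}

local notation "E" => EuclideanSpace ℝ (Fin N)

/-- Moving the derivative off `f` gives a mixed second derivative of `g`, which is symmetric; moving
it back exchanges the directions. -/
theorem integral_inner_fderiv_comm {f g : E → ℂ} (hf : ContDiff ℝ ∞ f) (hg : ContDiff ℝ ∞ g)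
    (hfc : HasCompactSupport f) (a b : E) :
    ∫ x, inner ℝ (fderiv ℝ f x a) (fderiv ℝ g x b) =
      ∫ x, inner ℝ (fderiv ℝ f x b) (fderiv ℝ g x a) := by
  have hf1 : ContDiff ℝ 1 f := hf.of_le (by simp)
  have h2 : (1 + 1 : WithTop ℕ∞) ≤ ∞ := by
    rw [one_add_one_eq_two]
    exact WithTop.coe_le_coe.2 (le_top : (2 : ℕ∞) ≤ ⊤)
  have hd : ∀ c : E, ContDiff ℝ 1 fun x => fderiv ℝ g x c := fun c =>
    (hg.fderiv_right (m := 1) h2).clm_apply contDiff_const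
  have hcf : ∀ c : E, Continuous fun x => fderiv ℝ f x c := fun c =>
    (hf1.continuous_fderiv (by norm_num)).clm_apply continuous_const
  have hcg : ∀ c d : E, Continuous fun x => fderiv ℝ (fun z => fderiv ℝ g z c) x d := fun c d =>
    ((hd c).continuous_fderiv (by norm_num)).clm_apply continuous_const
  have hzero : ∀ {k : E → ℂ} {l : E → ℂ}, Continuous k → Continuous l → HasCompactSupport k →
      Integrable (fun x => inner ℝ (k x) (l x)) volume := fun hk hl hc => by
    refine (hk.inner hl).integrable_of_hasCompactSupport (hc.mono' ?_)
    refine subset_trans ?_ subset_closure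
    intro x hx h0
    exact hx (by simp only [h0, inner_zero_left])
  have parts : ∀ c d : E, ∫ x, inner ℝ (f x) (fderiv ℝ (fun z => fderiv ℝ g z c) x d) =
      -∫ x, inner ℝ (fderiv ℝ f x d) (fderiv ℝ g x c) := fun c d =>
    integral_bilinear_fderiv_right_eq_neg_left_of_integrable (B := innerSL ℝ)
      (hzero (hcf d) (hd c).continuous (hfc.fderiv_apply ℝ d))
      (hzero hf1.continuous (hcg c d) hfc)
      (hzero hf1.continuous (hd c).continuous hfc)
      (fun x _ => hf1.differentiable (by norm_num) x)
      (fun x _ => (hd c).differentiable (by norm_num) x)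
  have hsymm : ∀ x, fderiv ℝ (fun z => fderiv ℝ g z b) x a =
      fderiv ℝ (fun z => fderiv ℝ g z a) x b := fun x => by
    have hdd : DifferentiableAt ℝ (fderiv ℝ g) x :=
      (hg.fderiv_right (m := 1) h2).differentiable (by norm_num) x
    have hs : IsSymmSndFDerivAt ℝ g x := hg.contDiffAt.isSymmSndFDerivAt
      (by rw [minSmoothness_of_isRCLikeNormedField, ← one_add_one_eq_two]; exact h2)
    have e : ∀ c d : E, fderiv ℝ (fun z => fderiv ℝ g z c) x d =
        fderiv ℝ (fderiv ℝ g) x d c := fun c d => by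
      rw [fderiv_clm_apply hdd (differentiableAt_const c)]
      simp
    rw [e, e, hs.eq]
  have h1 := parts b a
  have h2 := parts a b
  simp only [hsymm] at h1
  rw [h1] at h2
  exact neg_injective h2

theorem memLp_coord {m : ℕ} {μ : Measure E} {f : E → EuclideanSpace ℂ (Fin m)}
    (hf : MemLp f 2 μ) (i : Fin m) : MemLp (fun x => f x i) 2 μ :=
  (EuclideanSpace.proj (𝕜 := ℂ) i).comp_memLp' hf

theorem integrable_inner_of_memLp {V : Type*} [NormedAddCommGroup V] [InnerProductSpace ℝ V]
    {μ : Measure E} {f g : E → V} (hf : MemLp f 2 μ) (hg : MemLp g 2 μ) :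
    Integrable (fun x => inner ℝ (f x) (g x)) μ := by
  refine (hf.norm.integrable_mul hg.norm).mono' (hf.1.inner hg.1) ?_
  exact Eventually.of_forall fun x => norm_inner_le_norm _ _

theorem norm_apply_le {m : ℕ} (v : EuclideanSpace ℂ (Fin m)) (i : Fin m) : ‖v i‖ ≤ ‖v‖ :=
  PiLp.norm_apply_le v i

local notation "F" => EuclideanSpace ℂ (Fin N)

/-- Exchanging derivatives turns `∫ ∂_i η_i · ∂_j η_j` into `∫ ∂_j η_i · ∂_i η_j`, to which `2xy ≤
x² + y²` applies. Pointwise the inequality fails in general; only the integrated form has constant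
`1`. -/
theorem IsTestField.integral_div_sq_le {η : E → F} (hη : IsTestField Ω η) :
    ∫ x, ‖∑ k, partialDeriv k η x k‖ ^ 2 ≤ ∫ x, ∑ k, ‖partialDeriv k η x‖ ^ 2 := by
  have hcoord : ∀ i, ContDiff ℝ ∞ fun x => η x i := fun i =>
    ((EuclideanSpace.proj (𝕜 := ℂ) i : F →L[ℂ] ℂ).restrictScalars ℝ).contDiff.comp hη.contDiff
  have hcc : ∀ i, HasCompactSupport fun x => η x i := fun i =>
    hη.hasCompactSupport.comp_left (g := fun v : F => v i) rfl
  have hpd : ∀ h i x, partialDeriv h η x i =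
      fderiv ℝ (fun x => η x i) x (EuclideanSpace.single h 1) := fun h i x => by
    have h1 := ((EuclideanSpace.proj (𝕜 := ℂ) i : F →L[ℂ] ℂ).restrictScalars ℝ).hasFDerivAt.comp x
      (hη.contDiff_one.differentiable (by norm_num) x).hasFDerivAt
    have h2 : fderiv ℝ (fun x => η x i) x = _ := h1.fderiv
    rw [h2]
    rfl
  have hm : ∀ h, MemLp (partialDeriv h η) 2 (volume : Measure E) := fun h =>
    (continuous_partialDeriv hη.contDiff_one h).memLp_of_hasCompactSupport
      (hasCompactSupport_partialDeriv hη.hasCompactSupport h)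
  have hint : ∀ h i k j, Integrable (fun x => inner ℝ (partialDeriv h η x i)
      (partialDeriv k η x j)) (volume : Measure E) := fun h i k j =>
    integrable_inner_of_memLp (memLp_coord (hm h) i) (memLp_coord (hm k) j)
  calc ∫ x, ‖∑ k, partialDeriv k η x k‖ ^ 2
      = ∫ x, ∑ i, ∑ j, inner ℝ (partialDeriv i η x i) (partialDeriv j η x j) := by
        refine integral_congr_ae (Eventually.of_forall fun x => ?_)
        simp only [← real_inner_self_eq_norm_sq, sum_inner, inner_sum]
        exact Finset.sum_comm
    _ = ∑ i, ∑ j, ∫ x, inner ℝ (partialDeriv i η x i) (partialDeriv j η x j) := by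
        rw [integral_finsetSum _ fun i _ => integrable_finsetSum _ fun j _ => hint i i j j]
        refine Finset.sum_congr rfl fun i _ => ?_
        rw [integral_finsetSum _ fun j _ => hint i i j j]
    _ = ∑ i, ∑ j, ∫ x, inner ℝ (partialDeriv j η x i) (partialDeriv i η x j) := by
        refine Finset.sum_congr rfl fun i _ => Finset.sum_congr rfl fun j _ => ?_
        simp only [hpd]
        exact integral_inner_fderiv_comm (hcoord i) (hcoord j) (hcc i) _ _
    _ = ∫ x, ∑ i, ∑ j, inner ℝ (partialDeriv j η x i) (partialDeriv i η x j) := by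
        rw [integral_finsetSum _ fun i _ => integrable_finsetSum _ fun j _ => hint j i i j]
        refine Finset.sum_congr rfl fun i _ => ?_
        rw [integral_finsetSum _ fun j _ => hint j i i j]
    _ ≤ ∫ x, ∑ k, ‖partialDeriv k η x‖ ^ 2 := by
        refine integral_mono (integrable_finsetSum _ fun i _ => integrable_finsetSum _
          fun j _ => hint j i i j) (integrable_finsetSum _ fun k _ =>
            (memLp_two_iff_integrable_sq_norm (hm k).1).1 (hm k)) fun x => ?_
        have e1 : ∑ k, ‖partialDeriv k η x‖ ^ 2 = ∑ i, ∑ j, ‖partialDeriv j η x i‖ ^ 2 := by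
          rw [Finset.sum_comm]
          exact Finset.sum_congr rfl fun k _ => EuclideanSpace.norm_sq_eq _
        have e2 : ∑ k, ‖partialDeriv k η x‖ ^ 2 = ∑ i, ∑ j, ‖partialDeriv i η x j‖ ^ 2 :=
          Finset.sum_congr rfl fun k _ => EuclideanSpace.norm_sq_eq _
        have e3 : ∑ i, ∑ j, inner ℝ (partialDeriv j η x i) (partialDeriv i η x j) ≤
            ∑ i, ∑ j, (‖partialDeriv j η x i‖ ^ 2 + ‖partialDeriv i η x j‖ ^ 2) / 2 :=
          Finset.sum_le_sum fun i _ => Finset.sum_le_sum fun j _ => by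
            have := real_inner_le_norm (partialDeriv j η x i) (partialDeriv i η x j)
            nlinarith [sq_nonneg (‖partialDeriv j η x i‖ - ‖partialDeriv i η x j‖)]
        refine e3.trans (le_of_eq ?_)
        simp only [← Finset.sum_div, Finset.sum_add_distrib]
        rw [← e1, ← e2]
        ring

theorem HasGradH10.integral_div_sq_le {v : E → F} {Dv : Fin N → E → F}
    (hv : HasGradH10 Ω v Dv) :
    ∫ x in Ω, ‖∑ k, Dv k x k‖ ^ 2 ≤ ∫ x in Ω, ∑ k, ‖Dv k x‖ ^ 2 := by
  obtain ⟨η, h1, h2, h3⟩ := hv.approx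
  have hm : ∀ n h, MemLp (partialDeriv h (η n)) 2 (volume.restrict Ω) := fun n h =>
    (continuous_partialDeriv (h1 n).contDiff_one h).memLp_of_hasCompactSupport
      (hasCompactSupport_partialDeriv (h1 n).hasCompactSupport h)
  have hsq : ∀ {f : E → F}, MemLp f 2 (volume.restrict Ω) →
      Integrable (fun x => ‖f x‖ ^ 2) (volume.restrict Ω) := fun hf =>
    (memLp_two_iff_integrable_sq_norm hf.1).1 hf
  have L1 : Tendsto (fun n => ∫ x in Ω, ∑ k, ‖partialDeriv k (η n) x‖ ^ 2) atTop
      (𝓝 (∫ x in Ω, ∑ k, ‖Dv k x‖ ^ 2)) := by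
    rw [integral_finsetSum _ fun k _ => hsq (hv.memLp_grad k)]
    have e : ∀ n, ∫ x in Ω, ∑ k, ‖partialDeriv k (η n) x‖ ^ 2 =
        ∑ k, ∫ x in Ω, ‖partialDeriv k (η n) x‖ ^ 2 := fun n =>
      integral_finsetSum _ fun k _ => hsq (hm n k)
    simp only [e]
    exact tendsto_finsetSum _ fun k _ =>
      tendsto_integral_norm_sq (fun n => hm n k) (hv.memLp_grad k) (h3 k)
  have L2 : Tendsto (fun n => ∫ x in Ω, ‖∑ k, partialDeriv k (η n) x k‖ ^ 2) atTop
      (𝓝 (∫ x in Ω, ‖∑ k, Dv k x k‖ ^ 2)) := by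
    refine tendsto_integral_norm_sq
      (fun n => memLp_finsetSum _ fun k _ => memLp_coord (hm n k) k)
      (memLp_finsetSum _ fun k _ => memLp_coord (hv.memLp_grad k) k) ?_
    have hs := tendsto_finsetSum Finset.univ fun k _ => h3 k
    rw [Finset.sum_const_zero] at hs
    refine tendsto_of_tendsto_of_tendsto_of_le_of_le tendsto_const_nhds hs
      (fun _ => zero_le) fun n => ?_
    have := eLpNorm_sum_le (μ := volume.restrict Ω) (p := 2) (s := Finset.univ)
      (f := fun k x => partialDeriv k (η n) x k - Dv k x k)
      (fun k _ => ((memLp_coord (hm n k) k).sub (memLp_coord (hv.memLp_grad k) k)).1)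
      (by norm_num)
    refine le_trans (le_of_eq ?_) (this.trans (Finset.sum_le_sum fun k _ => ?_))
    · congr 1
      ext1 x
      rw [Finset.sum_apply, Finset.sum_sub_distrib]
    · exact eLpNorm_mono fun x => norm_apply_le (partialDeriv k (η n) x - Dv k x) k
  refine le_of_tendsto_of_tendsto' L2 L1 fun n => ?_
  have hout : ∀ k, ∀ x ∉ Ω, partialDeriv k (η n) x = 0 := fun k x hx =>
    image_eq_zero_of_notMem_tsupport fun h =>
      hx ((h1 n).tsupport_subset (tsupport_partialDeriv_subset _ _ h))
  rw [setIntegral_eq_integral_of_forall_compl_eq_zero,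
    setIntegral_eq_integral_of_forall_compl_eq_zero]
  · exact (h1 n).integral_div_sq_le
  · exact fun x hx => Finset.sum_eq_zero fun k _ => by rw [hout k x hx]; simp
  · intro x hx
    rw [Finset.sum_eq_zero fun k _ => by rw [hout k x hx]; simp]
    simp

/-! ### The Lamé form and its pointwise lower bound. -/

/-- The real part of the quadratic form of the Lamé operator as a bilinear form in two
gradients. -/
noncomputable def lameForm (lam mu : ℝ) (P Q : Fin N → F) : ℝ :=
  mu * ∑ h, inner ℝ (P h) (Q h) + (lam + mu) * inner ℝ (∑ h, P h h) (∑ h, Q h h)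

theorem lameForm_comb (lam mu a b c d : ℝ) (Z R : Fin N → F) :
    lameForm lam mu (fun k => a • Z k + b • R k) (fun k => c • Z k + d • R k) =
      a * c * lameForm lam mu Z Z + (a * d + b * c) * lameForm lam mu Z R +
        b * d * lameForm lam mu R R := by
  have e : ∀ (a b : ℝ), ∑ h, (a • Z h + b • R h) h = a • ∑ h, Z h h + b • ∑ h, R h h := by
    intro a b
    simp [Finset.sum_add_distrib, Finset.mul_sum]
  have e2 : ∑ h, inner ℝ (a • Z h + b • R h) (c • Z h + d • R h) =
      a * c * ∑ h, inner ℝ (Z h) (Z h) + (a * d + b * c) * ∑ h, inner ℝ (Z h) (R h) +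
        b * d * ∑ h, inner ℝ (R h) (R h) := by
    simp only [Finset.mul_sum, ← Finset.sum_add_distrib]
    refine Finset.sum_congr rfl fun h _ => ?_
    simp only [inner_add_left, inner_add_right, real_inner_smul_left, real_inner_smul_right,
      real_inner_comm (Z h) (R h)]
    ring
  simp only [lameForm, e]
  rw [e2]
  simp only [inner_add_left, inner_add_right, real_inner_smul_left,
    real_inner_smul_right, real_inner_comm (∑ h, Z h h) (∑ h, R h h)]
  ring

theorem lameForm_self (lam mu : ℝ) (P : Fin N → F) :
    lameForm lam mu P P = mu * ∑ h, ‖P h‖ ^ 2 + (lam + mu) * ‖∑ h, P h h‖ ^ 2 := by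
  simp only [lameForm, real_inner_self_eq_norm_sq]

/-- For a rank-one gradient the divergence is `∑ ρ_k e_k`, so Cauchy–Schwarz gives `|div|² ≤ |∇|²`
pointwise, without the factor `N` of a general matrix. -/
theorem lameForm_radial_le {lam mu : ℝ} (e : F) (ρ : Fin N → ℝ) :
    lameForm lam mu (fun k => ρ k • e) (fun k => ρ k • e) ≤
      (mu + max (lam + mu) 0) * ∑ k, ‖ρ k • e‖ ^ 2 := by
  rw [lameForm_self]
  have h1 : ‖∑ k, (ρ k • e) k‖ ^ 2 ≤ ∑ k, ‖ρ k • e‖ ^ 2 := by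
    have h2 : ‖∑ k, (ρ k • e) k‖ ≤ ∑ k, |ρ k| * ‖e k‖ :=
      (norm_sum_le _ _).trans (le_of_eq (Finset.sum_congr rfl fun k _ => by
        rw [PiLp.smul_apply, norm_smul, Real.norm_eq_abs]))
    calc ‖∑ k, (ρ k • e) k‖ ^ 2 ≤ (∑ k, |ρ k| * ‖e k‖) ^ 2 := by gcongr
      _ ≤ (∑ k, |ρ k| ^ 2) * ∑ k, ‖e k‖ ^ 2 := Finset.sum_mul_sq_le_sq_mul_sq _ _ _
      _ = ∑ k, ‖ρ k • e‖ ^ 2 := by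
        rw [← EuclideanSpace.norm_sq_eq, Finset.sum_mul]
        exact Finset.sum_congr rfl fun k _ => by rw [norm_smul, mul_pow, Real.norm_eq_abs]
  have h0 : 0 ≤ ‖∑ k, (ρ k • e) k‖ ^ 2 := by positivity
  have h3 : (lam + mu) * ‖∑ k, (ρ k • e) k‖ ^ 2 ≤
      max (lam + mu) 0 * ∑ k, ‖ρ k • e‖ ^ 2 :=
    (mul_le_mul_of_nonneg_right (le_max_left _ _) h0).trans
      (mul_le_mul_of_nonneg_left h1 (le_max_right _ _))
  linarith

/-- The differential of a radial map acts as `a` on vectors orthogonal to `y` and as `a + t a'`,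
with `t = |y|`, along `y`. -/
theorem radialDeriv_eq {V : Type*} [NormedAddCommGroup V] [InnerProductSpace ℝ V] (a : ℝ → ℝ)
    {y : V} (hy : y ≠ 0) (X : V) :
    radialDeriv a y X = a ‖y‖ • (X - (inner ℝ y X / ‖y‖ ^ 2) • y) +
      (a ‖y‖ + ‖y‖ * deriv a ‖y‖) • ((inner ℝ y X / ‖y‖ ^ 2) • y) := by
  have : ‖y‖ ≠ 0 := norm_ne_zero_iff.2 hy
  have e : deriv a ‖y‖ * (inner ℝ y X / ‖y‖) =
      ‖y‖ * deriv a ‖y‖ * (inner ℝ y X / ‖y‖ ^ 2) := by field_simp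
  rw [radialDeriv, e]
  module

/-- The pointwise lower bound for the form, where `|y| = s + s φ(s)`, `f = φ(s)`, `p = (s φ(s))'`
and `X` stands for the gradient of `y`. -/
theorem lameForm_radial_ge {lam mu c f p : ℝ} (hmu : 0 < mu) (hc : 0 ≤ c) (hf : 0 < f)
    (hp : 0 < p)
    (hfp : (f - p) ^ 2 ≤ c * (f + p) ^ 2) {y : F} (hy : y ≠ 0) {a b : ℝ → ℝ}
    (h1 : a ‖y‖ = 1 / (1 + f)) (h2 : b ‖y‖ = Real.sqrt f / (1 + f))
    (h3 : a ‖y‖ + ‖y‖ * deriv a ‖y‖ = 1 / (1 + p))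
    (h4 : b ‖y‖ + ‖y‖ * deriv b ‖y‖ = (f + p) / (2 * Real.sqrt f * (1 + p)))
    (X : Fin N → F) :
    lameForm lam mu (fun k => radialDeriv b y (X k)) (fun k => radialDeriv b y (X k)) -
        c * (mu + max (lam + mu) 0) * ∑ k, ‖radialDeriv b y (X k)‖ ^ 2 ≤
      lameForm lam mu (fun k => radialDeriv a y (X k))
        (fun k => X k - radialDeriv a y (X k)) := by
  set ρ : Fin N → ℝ := fun k => inner ℝ y (X k) / ‖y‖ ^ 2 with hρ
  set R : Fin N → F := fun k => ρ k • y with hR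
  set Z : Fin N → F := fun k => X k - R k with hZ
  set r := Real.sqrt f with hr
  have hr0 : 0 < r := Real.sqrt_pos.2 hf
  have hfr : f = r ^ 2 := (Real.sq_sqrt hf.le).symm
  have eA : ∀ k, radialDeriv a y (X k) = (1 / (1 + f)) • Z k + (1 / (1 + p)) • R k := fun k => by
    rw [radialDeriv_eq a hy, h3, h1]
  have eB : ∀ k, radialDeriv b y (X k) =
      (r / (1 + f)) • Z k + ((f + p) / (2 * r * (1 + p))) • R k := fun k => by
    rw [radialDeriv_eq b hy, h4, h2]
  have eC : ∀ k, X k - radialDeriv a y (X k) =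
      (1 - 1 / (1 + f)) • Z k + (1 - 1 / (1 + p)) • R k := fun k => by
    rw [eA, show X k = Z k + R k by simp [hZ]]
    module
  have hperp : ∀ k, inner ℝ (Z k) (R k) = 0 := fun k => by
    have : ‖y‖ ≠ 0 := norm_ne_zero_iff.2 hy
    change inner ℝ (X k - ρ k • y) (ρ k • y) = 0
    rw [inner_sub_left, real_inner_smul_right, real_inner_smul_right, real_inner_smul_left,
      real_inner_self_eq_norm_sq, real_inner_comm y (X k)]
    simp only [hρ]
    field_simp
    ring
  -- By orthogonality of `Z_k` and `R_k`, the radial part of `∇v` is no larger than `∇v`.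
  have hnorm : ∀ k, ((f + p) / (2 * r * (1 + p))) ^ 2 * ‖R k‖ ^ 2 ≤
      ‖radialDeriv b y (X k)‖ ^ 2 := fun k => by
    rw [eB, norm_add_sq_real, real_inner_smul_left, real_inner_smul_right, hperp, norm_smul _ (Z k),
      norm_smul _ (R k), mul_pow, mul_pow, Real.norm_eq_abs, Real.norm_eq_abs, sq_abs, sq_abs]
    have : 0 ≤ (r / (1 + f)) ^ 2 * ‖Z k‖ ^ 2 := by positivity
    linarith
  have hM : 0 ≤ mu + max (lam + mu) 0 := add_nonneg hmu.le (le_max_right _ _)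
  have hrad : lameForm lam mu R R ≤ (mu + max (lam + mu) 0) * ∑ k, ‖R k‖ ^ 2 :=
    lameForm_radial_le y ρ
  have hsum : ((f + p) / (2 * r * (1 + p))) ^ 2 * ∑ k, ‖R k‖ ^ 2 ≤
      ∑ k, ‖radialDeriv b y (X k)‖ ^ 2 := by
    rw [Finset.mul_sum]
    exact Finset.sum_le_sum fun k _ => hnorm k
  have hdef : (f - p) ^ 2 / (2 * r * (1 + p)) ^ 2 * lameForm lam mu R R ≤
      c * (mu + max (lam + mu) 0) * ∑ k, ‖radialDeriv b y (X k)‖ ^ 2 := by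
    have hS : 0 ≤ ∑ k, ‖R k‖ ^ 2 := Finset.sum_nonneg fun k _ => by positivity
    calc _ ≤ (f - p) ^ 2 / (2 * r * (1 + p)) ^ 2 *
          ((mu + max (lam + mu) 0) * ∑ k, ‖R k‖ ^ 2) := by gcongr
      _ ≤ (c * (f + p) ^ 2) / (2 * r * (1 + p)) ^ 2 *
          ((mu + max (lam + mu) 0) * ∑ k, ‖R k‖ ^ 2) := by gcongr
      _ = c * (mu + max (lam + mu) 0) *
          (((f + p) / (2 * r * (1 + p))) ^ 2 * ∑ k, ‖R k‖ ^ 2) := by rw [div_pow]; ring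
      _ ≤ _ := by gcongr
  -- The coefficients of `B(Z, Z)` and `B(Z, R)` agree on both sides; those of `B(R, R)` differ by
  -- `((f + p)² - 4fp) / (4f(1 + p)²)`, and `(f + p)² - 4fp = (f - p)²`.
  have hid : lameForm lam mu (fun k => radialDeriv a y (X k))
        (fun k => X k - radialDeriv a y (X k)) =
      lameForm lam mu (fun k => radialDeriv b y (X k)) (fun k => radialDeriv b y (X k)) -
        (f - p) ^ 2 / (2 * r * (1 + p)) ^ 2 * lameForm lam mu R R := by
    simp only [eC]
    simp only [eA, eB]
    rw [lameForm_comb, lameForm_comb, hfr]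
    field_simp
    ring
  rw [hid]
  linarith

theorem integrable_lameForm {μ : Measure E} (lam mu : ℝ) {P Q : Fin N → E → F}
    (hP : ∀ k, MemLp (P k) 2 μ) (hQ : ∀ k, MemLp (Q k) 2 μ) :
    Integrable (fun x => lameForm lam mu (fun k => P k x) (fun k => Q k x)) μ := by
  refine Integrable.add (Integrable.const_mul (integrable_finsetSum _ fun k _ =>
    integrable_inner_of_memLp (hP k) (hQ k)) _) (Integrable.const_mul ?_ _)
  exact integrable_inner_of_memLp (memLp_finsetSum _ fun k _ => memLp_coord (hP k) k)
    (memLp_finsetSum _ fun k _ => memLp_coord (hQ k) k)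

theorem re_sum_lameCoeff (lam mu : ℝ) (x : E) (P Q : Fin N → F) :
    (∑ h, ∑ k, ∑ i, ∑ j, lameCoeff lam mu h k x i j * P k j *
      (starRingEnd ℂ) (Q h i)).re = lameForm lam mu P Q := by
  have h1 : ∑ h, ∑ k, ∑ i, ∑ j, lameCoeff lam mu h k x i j * P k j * (starRingEnd ℂ) (Q h i) =
      (mu : ℂ) * (∑ h, ∑ i, P h i * (starRingEnd ℂ) (Q h i)) +
        ((lam + mu : ℝ) : ℂ) * ((∑ h, P h h) * (starRingEnd ℂ) (∑ h, Q h h)) := by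
    simp only [lameCoeff, Matrix.of_apply, add_mul, Finset.sum_add_distrib, mul_ite, ite_mul,
      mul_one, mul_zero, zero_mul, Finset.sum_ite_eq', Finset.mem_univ, if_true]
    congr 1
    · rw [Finset.mul_sum]
      refine Finset.sum_congr rfl fun h _ => ?_
      rw [Finset.sum_eq_single h (fun k _ hk => by simp [hk.symm]) (by simp)]
      simp [Finset.mul_sum, mul_assoc]
    · rw [map_sum, Finset.sum_mul_sum, Finset.sum_comm, Finset.mul_sum]
      rw [Finset.sum_comm (f := fun x y => (mu : ℂ) * P y y * (starRingEnd ℂ) (Q x x)),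
        ← Finset.sum_add_distrib]
      refine Finset.sum_congr rfl fun h _ => ?_
      rw [Finset.mul_sum, ← Finset.sum_add_distrib]
      refine Finset.sum_congr rfl fun k _ => ?_
      push_cast
      ring
  rw [h1, Complex.add_re, Complex.re_ofReal_mul, Complex.re_ofReal_mul, lameForm]
  congr 2
  · rw [Complex.re_sum]
    refine Finset.sum_congr rfl fun h _ => ?_
    rw [Complex.re_sum, PiLp.inner_apply]
    refine Finset.sum_congr rfl fun i _ => ?_
    rw [Complex.inner, ← Complex.conj_re]
    simp [mul_comm]
  · rw [Complex.inner, ← Complex.conj_re]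
    simp [mul_comm]

theorem re_systemForm_lame {lam mu : ℝ} {P Q : Fin N → E → F}
    (hP : ∀ k, MemLp (P k) 2 (volume.restrict Ω)) (hQ : ∀ k, MemLp (Q k) 2 (volume.restrict Ω)) :
    (systemForm Ω (lameCoeff lam mu) P Q).re =
      ∫ x in Ω, lameForm lam mu (fun k => P k x) (fun k => Q k x) := by
  have hi : Integrable (fun x => ∑ h, ∑ k, ∑ i, ∑ j, lameCoeff lam mu h k x i j * P k x j *
      (starRingEnd ℂ) (Q h x i)) (volume.restrict Ω) := by
    refine integrable_finsetSum _ fun h _ => integrable_finsetSum _ fun k _ =>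
      integrable_finsetSum _ fun i _ => integrable_finsetSum _ fun j _ => ?_
    simp only [mul_assoc]
    exact ((memLp_coord (hP k) j).integrable_mul (memLp_coord (hQ h) i).star).const_mul _
  rw [systemForm]
  have := integral_re hi
  simp only [RCLike.re_to_complex] at this
  rw [← this]
  simp only [re_sum_lameCoeff]

end

/-! ### Conclusion: integration of the pointwise bound. -/

theorem theorem7 (N : ℕ) (Ω : Set (EuclideanSpace ℝ (Fin N)))
    (hΩ_open : IsOpen Ω) (hΩ_conn : IsConnected Ω)
    (φ : ℝ → ℝ) (hφ : AdmissibleWeight φ)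
    (lam mu : ℝ) (hmu : 0 < mu) (hlam : 0 < lam + 2 * mu)
    (hΛ : weightLambdaInftySq φ <
      if 0 < lam + mu then mu / (lam + 2 * mu) else (lam + 2 * mu) / mu) :
    IsStrictlyFunctionalDissipative φ Ω (lameCoeff lam mu) := by
  set c := weightLambdaInftySq φ with hcdef
  have hc0 : 0 ≤ c := weightLambdaInftySq_nonneg φ
  set M := mu + max (lam + mu) 0 with hM
  -- Here `κ₀` is the coercivity constant of the form on `H̊¹`. The ratio `κ₀ / M` is the bound
  -- assumed on `Λ_∞²`, and `κ₀ ≤ M` forces `c < 1`.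
  obtain ⟨κ₀, hκ₀, hκM, hform⟩ : ∃ κ₀ : ℝ, c * M < κ₀ ∧ κ₀ ≤ M ∧
      ∀ (v : EuclideanSpace ℝ (Fin N) → EuclideanSpace ℂ (Fin N))
        (Dv : Fin N → EuclideanSpace ℝ (Fin N) → EuclideanSpace ℂ (Fin N)),
        HasGradH10 Ω v Dv → κ₀ * ∫ x in Ω, ∑ k, ‖Dv k x‖ ^ 2 ≤
          ∫ x in Ω, lameForm lam mu (fun k => Dv k x) (fun k => Dv k x) := by
    have hexp : ∀ (v : EuclideanSpace ℝ (Fin N) → EuclideanSpace ℂ (Fin N))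
        (Dv : Fin N → EuclideanSpace ℝ (Fin N) → EuclideanSpace ℂ (Fin N)),
        HasGradH10 Ω v Dv → ∫ x in Ω, lameForm lam mu (fun k => Dv k x) (fun k => Dv k x) =
          mu * (∫ x in Ω, ∑ k, ‖Dv k x‖ ^ 2) + (lam + mu) * ∫ x in Ω, ‖∑ k, Dv k x k‖ ^ 2 := by
      intro v Dv hv
      simp only [lameForm_self]
      have hd : MemLp (fun x => ∑ k, Dv k x k) 2 (volume.restrict Ω) :=
        memLp_finsetSum _ fun k _ => memLp_coord (hv.memLp_grad k) k
      rw [integral_add, integral_const_mul, integral_const_mul]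
      · exact (integrable_finsetSum _ fun k _ => (memLp_two_iff_integrable_sq_norm
          (hv.memLp_grad k).1).1 (hv.memLp_grad k)).const_mul _
      · exact ((memLp_two_iff_integrable_sq_norm hd.1).1 hd).const_mul _
    by_cases hlm : 0 < lam + mu
    · rw [if_pos hlm, lt_div_iff₀ hlam] at hΛ
      have hM' : M = lam + 2 * mu := by rw [hM, max_eq_left hlm.le]; ring
      refine ⟨mu, by rw [hM']; exact hΛ, by rw [hM']; linarith, fun v Dv hv => ?_⟩
      rw [hexp v Dv hv]
      have : 0 ≤ ∫ x in Ω, ‖∑ k, Dv k x k‖ ^ 2 := integral_nonneg fun x => by positivity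
      have := mul_nonneg hlm.le this
      linarith
    · rw [if_neg hlm, lt_div_iff₀ hmu] at hΛ
      have hM' : M = mu := by rw [hM, max_eq_right (not_lt.1 hlm), add_zero]
      refine ⟨lam + 2 * mu, by rw [hM']; exact hΛ, by rw [hM']; linarith, fun v Dv hv => ?_⟩
      rw [hexp v Dv hv]
      have := mul_le_mul_of_nonpos_left hv.integral_div_sq_le (not_lt.1 hlm)
      linarith
  have hMpos : 0 < M := add_pos_of_pos_of_nonneg hmu (le_max_right _ _)
  have hc1 : c < 1 := by
    by_contra! h
    nlinarith
  obtain ⟨a, b, L, ⟨ha, ha'⟩, ⟨hb, hb'⟩, hab⟩ := hφ.exists_profiles hc1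
  refine ⟨κ₀ - c * M, by linarith, fun u Du Dw hu hw => ?_⟩
  have hy := hu.add hw
  set y : EuclideanSpace ℝ (Fin N) → EuclideanSpace ℂ (Fin N) :=
    fun x => u x + φ ‖u x‖ • u x with hydef
  set Dy : Fin N → EuclideanSpace ℝ (Fin N) → EuclideanSpace ℂ (Fin N) :=
    fun h x => Du h x + Dw h x with hDy
  have hya := hy.radial hΩ_open ha (fun t ht => (ha' t ht).1) fun t ht => (ha' t ht).2
  have hyb := hy.radial hΩ_open hb (fun t ht => (hb' t ht).1) fun t ht => (hb' t ht).2
  have hyu : ∀ x, y x = (1 + φ ‖u x‖) • u x := fun x => by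
    simp only [hydef, add_smul, one_smul]
  have hnorm : ∀ x, u x ≠ 0 → ‖y x‖ = ‖u x‖ + ‖u x‖ * φ ‖u x‖ := fun x hx => by
    have := hφ.pos _ (norm_pos_iff.2 hx)
    rw [hyu, norm_smul, Real.norm_of_nonneg (by positivity)]
    ring
  have hya' : (fun x => a ‖y x‖ • y x) = u := by
    ext1 x
    by_cases hx : u x = 0
    · simp [hyu, hx]
    · have hp := hφ.pos _ (norm_pos_iff.2 hx)
      rw [(hab _ (norm_pos_iff.2 hx) _ (hnorm x hx)).1, hyu, smul_smul,
        one_div_mul_cancel (by positivity), one_smul]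
  have hyb' : (fun x => b ‖y x‖ • y x) = fun x => Real.sqrt (φ ‖u x‖) • u x := by
    ext1 x
    by_cases hx : u x = 0
    · simp [hyu, hx]
    · have hp := hφ.pos _ (norm_pos_iff.2 hx)
      rw [(hab _ (norm_pos_iff.2 hx) _ (hnorm x hx)).2.1, hyu, smul_smul,
        div_mul_cancel₀ _ (by positivity)]
  rw [hya'] at hya
  rw [hyb'] at hyb
  refine ⟨fun h x => radialDeriv b (y x) (Dy h x), hyb, ?_⟩
  set Dv : Fin N → EuclideanSpace ℝ (Fin N) → EuclideanSpace ℂ (Fin N) :=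
    fun h x => radialDeriv b (y x) (Dy h x) with hDv
  rw [re_systemForm_lame hu.memLp_grad hw.memLp_grad]
  have hsq : Integrable (fun x => ∑ k, ‖Dv k x‖ ^ 2) (volume.restrict Ω) :=
    integrable_finsetSum _ fun k _ => (memLp_two_iff_integrable_sq_norm
      (hyb.memLp_grad k).1).1 (hyb.memLp_grad k)
  have hmain : ∫ x in Ω, (lameForm lam mu (fun k => Dv k x) (fun k => Dv k x) -
      c * M * ∑ k, ‖Dv k x‖ ^ 2) ≤
        ∫ x in Ω, lameForm lam mu (fun k => Du k x) (fun k => Dw k x) := by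
    refine integral_mono_ae ((integrable_lameForm lam mu hyb.memLp_grad hyb.memLp_grad).sub
      (hsq.const_mul _)) (integrable_lameForm lam mu hu.memLp_grad hw.memLp_grad) ?_
    -- The given gradient of `u` agrees almost everywhere with the one from the chain rule through
    -- `y`, and `∇w = ∇y - ∇u`. Where `u = 0`, also `y = 0`, so `∇y` vanishes almost everywhere
    -- there and both integrands are zero.
    filter_upwards [ae_all_iff.2 fun k => hu.grad_unique hΩ_open hya k,
      ae_all_iff.2 fun k => hy.grad_eq_zero hΩ_open k] with x h1 h2
    have hDw : ∀ k, Dw k x = Dy k x - radialDeriv a (y x) (Dy k x) := fun k => by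
      rw [← h1 k]
      simp [hDy]
    simp only [hDw, h1]
    by_cases hx : u x = 0
    · have hyx : y x = 0 := by rw [hyu, hx, smul_zero]
      simp [hDv, h2 _ hyx, radialDeriv, hyx, lameForm]
    · have hs := norm_pos_iff.2 hx
      have hp := hφ.pos _ hs
      obtain ⟨k1, k2, k3, k4⟩ := hab _ hs _ (hnorm x hx)
      have hyx : y x ≠ 0 := by
        rw [hyu]
        exact smul_ne_zero (by positivity) hx
      exact lameForm_radial_ge hmu hc0 hp (hφ.deriv_pos _ hs) (hφ.sq_sub_le hs) hyx
        k1 k2 k3 k4 fun k => Dy k x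
  rw [integral_sub (integrable_lameForm lam mu hyb.memLp_grad hyb.memLp_grad)
    (hsq.const_mul _), integral_const_mul] at hmain
  have := hform _ Dv hyb
  linarith
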